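/- Let $\mathbb T$ be the unit circle with normalized Haar measure, $e_n(z)=z^n$, let $H^2\subset L^2(\mathbb T)$ be the closed span of $\{e_n:n\ge 0\}$ and $P$ the orthogonal projection of $L^2(\mathbb T)$ onto $H^2$. For $f\in L^\infty(\mathbb T)$ and $\lambda\in\mathbb T$ let $M_f$ be multiplication by $f$ on $L^2(\mathbb T)$, let $(V_\lambda h)(z)=h(\lambda z)$, and let $T_{\lambda,f}=PM_fV_\lambda|_{H^2}$. Let $S=PM_z|_{H^2}$ be the unilateral shift and $\tau(X)=S^*XS$ for $X\in B(H^2)$. For a linear map $\sigma$ put $E_\lambda(\sigma)=\{x:\sigma(x)=\lambda x\}$ and let $\mathcal P(\sigma)$ be the norm closure of the linear span of $\bigcup_{\lambda\in\mathbb T}E_\lambda(\sigma)$. A minimal dilation of $\tau$ is a triple $(K,B,\theta)$ of a Hilbert space $K\supseteq H^2$, a von Neumann algebra $B\subseteq B(K)$ and a normal unital $*$-endomorphism $\theta$ of $B$ such that, with $p$ the projection of $K$ onto $H^2$ and $x\in B(H^2)$ identified with $pxp\in B(K)$: $pBp=B(H^2)$, with $B(H^2)\subseteq B$; $\tau^n(x)=p\theta^n(x)p$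 for all $x\in B(H^2)$, $n\ge 0$; the vectors $\theta^n(x_n)\cdots\theta(x_1)h$ ($n\ge0$, $x_j\in B(H^2)$, $h\in H^2$) span a dense subspace of $K$; and $B$ is the von Neumann algebra generated by all $\theta^n(x)$, $n\ge0$, $x\in B(H^2)$. The peripheral Poisson boundary of $\tau$ is $\mathcal P(\tau)$ with the norm and involution of $B(H^2)$ and the product $x\circ y=T(T^{-1}(x)T^{-1}(y))$, where $T:\mathcal P(\theta)\to\mathcal P(\tau)$, $T(b)=pbp|_{H^2}$. **Theorem.** Let $\alpha$ be the action of $\mathbb T$ on $L^\infty(\mathbb T)$ by $*$-automorphisms, $(\alpha_\lambda f)(z)=f(\lambda^{-1}z)$, and let $\pi(f)=M_f$, $u(\lambda)=V_{\bar\lambda}$. 1. $(\pi,u)$ is a covariant representation of $(\mathbb T,L^\infty(\mathbb T),\alpha)$ on $L^2(\mathbb T)$: $\pi$ is a unital $*$-representation, $u$ is a strongly continuous unitary representation, and $u(\lambda)\pi(f)u(\lambda)^*=\pi(\alpha_\lambda f)$. 2. $E_\lambda(\tau)=\{T_{\lambda,f}:f\in L^\infty(\mathbb T)\}$ for every $\lambda\in\mathbb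 T$. 3. $(L^2(\mathbb T),B(L^2(\mathbb T)),\theta_0)$ with $\theta_0(Z)=M_z^*ZM_z$ is a minimal dilation of $\tau$, and $\mathcal P(\theta_0)$ is the $C^*$-algebra $C^*(\pi,u)$ generated by $\pi(L^\infty(\mathbb T))\cup u(\mathbb T)$. 4. For every minimal dilation $(K,B,\theta)$ of $\tau$, the map $T:\mathcal P(\theta)\to\mathcal P(\tau)$ is an isometric bijection, and the product $\circ$ that it defines satisfies $$T_{\lambda,f}\circ T_{\mu,g}=T_{\lambda\mu,\,f(\cdot)g(\lambda\,\cdot)}\qquad(\lambda,\mu\in\mathbb T,\ f,g\in L^\infty(\mathbb T)).$$ Moreover $X\mapsto PX|_{H^2}$ is an isometric unital $*$-isomorphism of $C^*(\pi,u)$ onto the peripheral Poisson boundary $(\mathcal P(\tau),\circ)$ of $\tau$. -/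

import Mathlib

open MeasureTheory
open scoped ENNReal

/-! ### Peripheral eigenvectors and minimal dilations -/

section Dilation

variable {H : Type*} [NormedAddCommGroup H] [InnerProductSpace ℂ H] [CompleteSpace H]
variable {K : Type*} [NormedAddCommGroup K] [InnerProductSpace ℂ K] [CompleteSpace K]

/-- The compression `b ↦ P b|_H` to a Hilbert space `H`, isometrically embedded in `K` by `ι`
(the adjoint of `ι` is the orthogonal projection of `K` onto `H`). -/
noncomputable def compress (ι : H →ₗᵢ[ℂ] K) (b : K →L[ℂ] K) : H →L[ℂ] H :=
  ContinuousLinearMap.adjoint ι.toContinuousLinearMap ∘L b ∘L ι.toContinuousLinearMap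

/-- The operator `x` on `H` regarded as an operator on `K ⊇ H` that vanishes on the orthogonal
complement of `H`. -/
noncomputable def inflate (ι : H →ₗᵢ[ℂ] K) (x : H →L[ℂ] H) : K →L[ℂ] K :=
  ι.toContinuousLinearMap ∘L x ∘L ContinuousLinearMap.adjoint ι.toContinuousLinearMap

/-- The norm closure of the linear span of all eigenvectors of `T` with eigenvalue of modulus
one. -/
def peripheralSpace {V : Type*} [AddCommGroup V] [Module ℂ V] [TopologicalSpace V]
    [ContinuousAdd V] [ContinuousConstSMul ℂ V] (T : Module.End ℂ V) : Submodule ℂ V :=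
  (⨆ l : Circle, Module.End.eigenspace T (l : ℂ)).topologicalClosure

/-- The operator `θⁿ(x)` on `K`, for `x ∈ B(H) ⊆ B`. -/
noncomputable def dilationPower {ι : H →ₗᵢ[ℂ] K} {B : VonNeumannAlgebra K}
    (hB : ∀ x : H →L[ℂ] H, inflate ι x ∈ B.toStarSubalgebra)
    (θ : B.toStarSubalgebra →⋆ₐ[ℂ] B.toStarSubalgebra) (n : ℕ) (x : H →L[ℂ] H) : K →L[ℂ] K :=
  (θ^[n] ⟨inflate ι x, hB x⟩ : B.toStarSubalgebra).1

/-- The vector `θⁿ(xₙ) θⁿ⁻¹(xₙ₋₁) ⋯ θ(x₁) h` of `K`. -/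
noncomputable def dilationWord {ι : H →ₗᵢ[ℂ] K} {B : VonNeumannAlgebra K}
    (hB : ∀ x : H →L[ℂ] H, inflate ι x ∈ B.toStarSubalgebra)
    (θ : B.toStarSubalgebra →⋆ₐ[ℂ] B.toStarSubalgebra) (x : ℕ → (H →L[ℂ] H)) (h : H) : ℕ → K
  | 0 => ι h
  | n + 1 => dilationPower hB θ (n + 1) (x (n + 1)) (dilationWord hB θ x h n)

/-- `(K, B, θ)`, with `H` embedded in `K` by `ι`, is a minimal dilation of the map `τ` on `B(H)`:
`θ` is a normal unital `*`-endomorphism of the von Neumann algebra `B` on `K`.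

The field `inflate_mem` says that `B(H) ⊆ B`, that is, `p B p = B(H)` for the projection `p` of
`K` onto `H`. Normality of `θ` is preservation of suprema of bounded increasing nets in the usual
order of operators. -/
structure IsMinimalDilation (τ : Module.End ℂ (H →L[ℂ] H)) (ι : H →ₗᵢ[ℂ] K)
    (B : VonNeumannAlgebra K) (θ : B.toStarSubalgebra →⋆ₐ[ℂ] B.toStarSubalgebra) : Prop where
  inflate_mem : ∀ x : H →L[ℂ] H, inflate ι x ∈ B.toStarSubalgebra
  normal : ScottContinuous θ
  dilation : ∀ (n : ℕ) (x : H →L[ℂ] H), (τ ^ n) x = compress ι (dilationPower inflate_mem θ n x)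
  minimal_space : (Submodule.span ℂ {k : K | ∃ (n : ℕ) (x : ℕ → (H →L[ℂ] H)) (h : H),
    k = dilationWord inflate_mem θ x h n}).topologicalClosure = ⊤
  minimal_algebra : ∀ C : VonNeumannAlgebra K,
    (∀ (n : ℕ) (x : H →L[ℂ] H), dilationPower inflate_mem θ n x ∈ C) → B ≤ C

/-- The `C*`-algebra of a dilation: the closed span of the peripheral eigenvectors of `θ`. -/
noncomputable def dilationPeripheralSpace {B : VonNeumannAlgebra K}
    (θ : B.toStarSubalgebra →⋆ₐ[ℂ] B.toStarSubalgebra) : Submodule ℂ B.toStarSubalgebra :=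
  peripheralSpace (V := B.toStarSubalgebra) θ.toAlgHom.toLinearMap

/-- The product `x ∘ y = T (T⁻¹ x · T⁻¹ y)` of the peripheral Poisson boundary, where `T` is the
compression restricted to the closed span of the peripheral eigenvectors of `θ`. -/
noncomputable def poissonMul (ι : H →ₗᵢ[ℂ] K) {B : VonNeumannAlgebra K}
    (θ : B.toStarSubalgebra →⋆ₐ[ℂ] B.toStarSubalgebra) (x y : H →L[ℂ] H) : H →L[ℂ] H :=
  let T : B.toStarSubalgebra → (H →L[ℂ] H) := fun b => compress ι b.1
  let lift : (H →L[ℂ] H) → B.toStarSubalgebra :=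
    Function.invFunOn T (dilationPeripheralSpace θ : Set B.toStarSubalgebra)
  T (lift x * lift y)

/-- The von Neumann algebra `B(K)` of all bounded operators. -/
noncomputable def fullVonNeumannAlgebra (K : Type*) [NormedAddCommGroup K]
    [InnerProductSpace ℂ K] [CompleteSpace K] : VonNeumannAlgebra K where
  toStarSubalgebra := ⊤
  centralizer_centralizer' := by
    apply Set.eq_univ_of_forall
    intro x y hy
    exact (hy x (by trivial)).symm

end Dilation

/-! ### Actions and covariant representations -/

section Covariant

variable {G A K : Type*} [Group G] [TopologicalSpace G] [Ring A] [StarRing A] [Algebra ℂ A]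
variable [NormedAddCommGroup K] [InnerProductSpace ℂ K] [CompleteSpace K]

/-- `(π, u)` is a covariant representation on `K` of the action `α` of `G` on `A` by
`*`-automorphisms: `u` is strongly continuous and `u(g) π(a) u(g)* = π(α_g(a))`. -/
structure IsCovariantRepresentation (α : G →* (A ≃⋆ₐ[ℂ] A)) (π : A →⋆ₐ[ℂ] (K →L[ℂ] K))
    (u : G →* unitary (K →L[ℂ] K)) : Prop where
  strongly_continuous : ∀ k : K, Continuous fun g => (u g : K →L[ℂ] K) k
  covariant : ∀ (g : G) (a : A),
    (u g : K →L[ℂ] K) * π a * star (u g : K →L[ℂ] K) = π (α g a)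

/-- The `C*`-algebra of operators generated by the images of `π` and `u`. -/
noncomputable def generatedCStarAlgebra (π : A →⋆ₐ[ℂ] (K →L[ℂ] K))
    (u : G →* unitary (K →L[ℂ] K)) : StarSubalgebra ℂ (K →L[ℂ] K) :=
  (StarAlgebra.adjoin ℂ
    (Set.range π ∪ Set.range fun g => (u g : K →L[ℂ] K))).topologicalClosure

end Covariant

/-! ### The unit circle -/

section Circle

noncomputable instance instMeasurableSpaceCircle : MeasurableSpace Circle := borel Circle

instance instBorelSpaceCircle : BorelSpace Circle := ⟨rfl⟩

/-- The normalized Haar measure of the unit circle. -/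
noncomputable def circleHaar : Measure Circle := Measure.haarMeasure ⊤

instance instIsHaarMeasureCircleHaar : circleHaar.IsHaarMeasure :=
  inferInstanceAs (Measure.haarMeasure ⊤).IsHaarMeasure

instance instIsProbabilityMeasureCircleHaar : IsProbabilityMeasure circleHaar :=
  ⟨Measure.haarMeasure_self⟩

/-- `L²(𝕋)`. -/
abbrev CircleL2 : Type := Lp ℂ 2 circleHaar

/-- `L^∞(𝕋)`. -/
abbrev CircleLInf : Type := Lp ℂ ∞ circleHaar

end Circle

namespace CircleLInf

/-- Pointwise multiplication on `L^∞(𝕋)`. -/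
noncomputable instance instMul : Mul CircleLInf where
  mul f g := (f • g : Lp ℂ ∞ circleHaar)

theorem coeFn_mul (f g : CircleLInf) :
    (f * g : CircleLInf) =ᵐ[circleHaar] fun z => f z * g z :=
  Lp.coeFn_lpSMul f g

/-- The constant function one. -/
noncomputable instance instOne : One CircleLInf where
  one := Lp.const ∞ circleHaar (1 : ℂ)

theorem coeFn_one : (1 : CircleLInf) =ᵐ[circleHaar] fun _ => (1 : ℂ) :=
  Lp.coeFn_const ∞ circleHaar (1 : ℂ)

noncomputable instance instCommRing : CommRing CircleLInf where
  __ := (inferInstance : AddCommGroup CircleLInf)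
  mul := (· * ·)
  one := 1
  mul_comm f g := by
    apply Lp.ext
    filter_upwards [coeFn_mul f g, coeFn_mul g f] with z h1 h2
    rw [h1, h2, mul_comm]
  mul_assoc f g h := by
    apply Lp.ext
    filter_upwards [coeFn_mul (f * g) h, coeFn_mul f (g * h), coeFn_mul f g, coeFn_mul g h]
      with z h1 h2 h3 h4
    rw [h1, h2, h3, h4, mul_assoc]
  one_mul f := by
    apply Lp.ext
    filter_upwards [coeFn_mul 1 f, coeFn_one] with z h1 h2
    rw [h1, h2, one_mul]
  mul_one f := by
    apply Lp.ext
    filter_upwards [coeFn_mul f 1, coeFn_one] with z h1 h2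
    rw [h1, h2, mul_one]
  zero_mul f := Lp.zero_smul ℂ ∞ f
  mul_zero f := Lp.smul_zero ℂ ∞ f
  left_distrib f g h := Lp.add_smul f g h
  right_distrib f g h := Lp.smul_add f g h

noncomputable instance instAlgebra : Algebra ℂ CircleLInf :=
  Algebra.ofModule (fun c f g => Lp.smul_assoc c f g)
    (fun c f g => (Lp.smul_comm c f g).symm)

noncomputable instance instStarRing : StarRing CircleLInf where
  star_mul f g := by
    apply Lp.ext
    filter_upwards [Lp.coeFn_star (f * g), coeFn_mul (star g) (star f), coeFn_mul f g,
      Lp.coeFn_star f, Lp.coeFn_star g] with z h1 h2 h3 h4 h5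
    rw [h1, h2, h4, h5, Pi.star_apply, Pi.star_apply, Pi.star_apply, h3, star_mul]
  star_add f g := by
    apply Lp.ext
    filter_upwards [Lp.coeFn_star (f + g), Lp.coeFn_add (star f) (star g), Lp.coeFn_add f g,
      Lp.coeFn_star f, Lp.coeFn_star g] with z h1 h2 h3 h4 h5
    rw [h1, h2, Pi.add_apply, h4, h5, Pi.star_apply, Pi.star_apply, Pi.star_apply, h3,
      Pi.add_apply, star_add]

end CircleLInf

/-! ### Rotations, multiplication operators and the covariant representation -/

section Representation

theorem measurePreserving_rotation (l : Circle) :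
    MeasurePreserving (fun z : Circle => l * z) circleHaar circleHaar :=
  measurePreserving_mul_left circleHaar l

/-- The multiplication operator `M_f` on `L²(𝕋)`. -/
noncomputable def mulOp (f : CircleLInf) : CircleL2 →L[ℂ] CircleL2 :=
  (ContinuousLinearMap.mul ℂ ℂ).holderL circleHaar ∞ 2 2 f

theorem coeFn_mulOp (f : CircleLInf) (h : CircleL2) :
    mulOp f h =ᵐ[circleHaar] fun z => f z * h z :=
  (ContinuousLinearMap.mul ℂ ℂ).coeFn_holder f h

/-- The operator `V_l` on `L²(𝕋)`, `(V_l h)(z) = h(l z)`. -/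
noncomputable def rotOp (l : Circle) : CircleL2 →L[ℂ] CircleL2 :=
  (Lp.compMeasurePreservingₗᵢ ℂ (fun z : Circle => l * z)
    (measurePreserving_rotation l)).toContinuousLinearMap

theorem coeFn_rotOp (l : Circle) (h : CircleL2) :
    rotOp l h =ᵐ[circleHaar] fun z => h (l * z) :=
  Lp.coeFn_compMeasurePreserving h (measurePreserving_rotation l)

/-- The function `z ↦ f(l z)` for `f ∈ L^∞(𝕋)`. -/
noncomputable def rotFun (l : Circle) (f : CircleLInf) : CircleLInf :=
  Lp.compMeasurePreserving (fun z : Circle => l * z) (measurePreserving_rotation l) f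

theorem coeFn_rotFun (l : Circle) (f : CircleLInf) :
    rotFun l f =ᵐ[circleHaar] fun z => f (l * z) :=
  Lp.coeFn_compMeasurePreserving f (measurePreserving_rotation l)

theorem rotFun_rotFun (l m : Circle) (f : CircleLInf) :
    rotFun l (rotFun m f) = rotFun (l * m) f := by
  apply Lp.ext
  filter_upwards [coeFn_rotFun l (rotFun m f), coeFn_rotFun (l * m) f,
    (measurePreserving_rotation l).quasiMeasurePreserving.ae (coeFn_rotFun m f)] with z h1 h2 h3
  rw [h1, h2, h3, mul_comm l m, mul_assoc]

theorem rotFun_one (f : CircleLInf) : rotFun 1 f = f := by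
  apply Lp.ext
  filter_upwards [coeFn_rotFun 1 f] with z h1
  rw [h1, one_mul]

theorem rotOp_rotOp (l m : Circle) : rotOp l * rotOp m = rotOp (l * m) := by
  ext1 h
  apply Lp.ext
  filter_upwards [coeFn_rotOp l (rotOp m h), coeFn_rotOp (l * m) h,
    (measurePreserving_rotation l).quasiMeasurePreserving.ae (coeFn_rotOp m h)] with z h1 h2 h3
  rw [mul_apply_eq_comp, h1, h2, h3, mul_comm l m, mul_assoc]

theorem rotOp_one : rotOp 1 = 1 := by
  ext1 h
  apply Lp.ext
  filter_upwards [coeFn_rotOp 1 h] with z h1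
  rw [h1, one_mul, one_apply_eq_self]

/-- The action `α` of the circle group on `L^∞(𝕋)`, `(α_l f)(z) = f(l⁻¹ z)`. -/
noncomputable def rotationAction : Circle →* (CircleLInf ≃⋆ₐ[ℂ] CircleLInf) where
  toFun l :=
    { toFun := rotFun l⁻¹
      invFun := rotFun l
      left_inv := fun f => by rw [rotFun_rotFun, mul_inv_cancel, rotFun_one]
      right_inv := fun f => by rw [rotFun_rotFun, inv_mul_cancel, rotFun_one]
      map_mul' := fun f g => by
        apply Lp.ext
        filter_upwards [coeFn_rotFun l⁻¹ (f * g),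
          CircleLInf.coeFn_mul (rotFun l⁻¹ f) (rotFun l⁻¹ g), coeFn_rotFun l⁻¹ f,
          coeFn_rotFun l⁻¹ g, (measurePreserving_rotation l⁻¹).quasiMeasurePreserving.ae
            (CircleLInf.coeFn_mul f g)] with z h1 h2 h3 h4 h5
        rw [h1, h2, h3, h4, h5]
      map_add' := fun f g => map_add _ f g
      map_star' := fun f => by
        apply Lp.ext
        filter_upwards [coeFn_rotFun l⁻¹ (star f), Lp.coeFn_star (rotFun l⁻¹ f),
          coeFn_rotFun l⁻¹ f, (measurePreserving_rotation l⁻¹).quasiMeasurePreserving.ae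
            (Lp.coeFn_star f)] with z h1 h2 h3 h4
        rw [h1, h2, h4, Pi.star_apply, Pi.star_apply, h3]
      map_smul' := fun c f =>
        (Lp.compMeasurePreservingₗ ℂ _ (measurePreserving_rotation l⁻¹)).map_smul c f }
  map_one' := by
    ext1 f
    change rotFun 1⁻¹ f = f
    rw [inv_one, rotFun_one]
  map_mul' l m := by
    ext1 f
    change rotFun (l * m)⁻¹ f = rotFun l⁻¹ (rotFun m⁻¹ f)
    rw [rotFun_rotFun, mul_inv]

/-- The representation `π(f) = M_f` of `L^∞(𝕋)` on `L²(𝕋)`. -/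
noncomputable def mulRep : CircleLInf →⋆ₐ[ℂ] (CircleL2 →L[ℂ] CircleL2) where
  toFun := mulOp
  map_one' := by
    ext1 h
    apply Lp.ext
    filter_upwards [coeFn_mulOp 1 h, CircleLInf.coeFn_one] with z h1 h2
    rw [h1, h2, one_mul, one_apply_eq_self]
  map_mul' f g := by
    ext1 h
    apply Lp.ext
    filter_upwards [coeFn_mulOp (f * g) h, coeFn_mulOp f (mulOp g h), coeFn_mulOp g h,
      CircleLInf.coeFn_mul f g] with z h1 h2 h3 h4
    rw [h1, h4, mul_apply_eq_comp, h2, h3, mul_assoc]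
  map_zero' := map_zero _
  map_add' f g := map_add _ f g
  commutes' c := by
    ext1 h
    apply Lp.ext
    filter_upwards [coeFn_mulOp (algebraMap ℂ CircleLInf c) h, CircleLInf.coeFn_one,
      Lp.coeFn_smul c (1 : CircleLInf), Lp.coeFn_smul c h] with z h1 h2 h3 h4
    rw [Algebra.algebraMap_eq_smul_one] at h1
    rw [Algebra.algebraMap_eq_smul_one, h1, h3, Pi.smul_apply, h2,
      Algebra.algebraMap_eq_smul_one, _root_.smul_apply,
      one_apply_eq_self, h4]
    simp
  map_star' f := by
    rw [ContinuousLinearMap.star_eq_adjoint, ContinuousLinearMap.eq_adjoint_iff]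
    intro h k
    rw [L2.inner_def, L2.inner_def]
    apply integral_congr_ae
    filter_upwards [coeFn_mulOp (star f) h, coeFn_mulOp f k, Lp.coeFn_star f] with z h1 h2 h3
    rw [h1, h2, h3]
    simp only [Pi.star_apply, RCLike.inner_apply, map_mul, RCLike.star_def, Complex.conj_conj]
    ring

theorem rotOp_mem_unitary (l : Circle) : rotOp l ∈ unitary (CircleL2 →L[ℂ] CircleL2) := by
  have h1 : star (rotOp l) * rotOp l = 1 :=
    (rotOp l).norm_map_iff_adjoint_comp_self.mp
      (Lp.norm_compMeasurePreserving · (measurePreserving_rotation l))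
  have h2 : rotOp l * rotOp l⁻¹ = 1 := by rw [rotOp_rotOp, mul_inv_cancel, rotOp_one]
  refine ⟨h1, ?_⟩
  rwa [left_inv_eq_right_inv h1 h2]

/-- The unitary representation `u(l) = V_{l̄}` of the circle group on `L²(𝕋)`. -/
noncomputable def rotRep : Circle →* unitary (CircleL2 →L[ℂ] CircleL2) where
  toFun l := ⟨rotOp l⁻¹, rotOp_mem_unitary l⁻¹⟩
  map_one' := by
    ext1
    change rotOp 1⁻¹ = 1
    rw [inv_one, rotOp_one]
  map_mul' l m := by
    ext1
    change rotOp (l * m)⁻¹ = rotOp l⁻¹ * rotOp m⁻¹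
    rw [rotOp_rotOp, mul_inv]

end Representation

/-! ### The Hardy space and Toeplitz operators -/

section Toeplitz

/-- The function `e_n(z) = z^n` in `L²(𝕋)`, for `n ≥ 0`. -/
noncomputable def monomialL2 (n : ℕ) : CircleL2 :=
  ContinuousMap.toLp 2 circleHaar ℂ ⟨fun z : Circle => (z : ℂ) ^ n, by fun_prop⟩

/-- The Hardy space `H²`, the closed span of the `e_n` with `n ≥ 0`. -/
noncomputable def hardySpace : Submodule ℂ CircleL2 :=
  (Submodule.span ℂ (Set.range monomialL2)).topologicalClosure

instance instCompleteSpaceHardySpace : CompleteSpace hardySpace :=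
  inferInstanceAs (CompleteSpace (Submodule.span ℂ (Set.range monomialL2)).topologicalClosure)

/-- The inclusion of `H²` in `L²(𝕋)`. -/
noncomputable def hardyIncl : hardySpace →ₗᵢ[ℂ] CircleL2 := hardySpace.subtypeₗᵢ

/-- The `l`-Toeplitz operator `T_{l,f} = P M_f V_l|_{H²}`; the usual Toeplitz operator with
symbol `f` is `T_{1,f}`. -/
noncomputable def toeplitz (l : Circle) (f : CircleLInf) : hardySpace →L[ℂ] hardySpace :=
  compress hardyIncl (mulOp f * rotOp l)

/-- The function `z` in `L^∞(𝕋)`. -/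
noncomputable def coordFun : CircleLInf :=
  ContinuousMap.toLp ∞ circleHaar ℂ ⟨fun z : Circle => (z : ℂ), by fun_prop⟩

/-- The unilateral shift on `H²`, the Toeplitz operator with symbol `z`. -/
noncomputable def shift : hardySpace →L[ℂ] hardySpace := compress hardyIncl (mulOp coordFun)

/-- The map `τ(X) = S* X S` on `B(H²)`. -/
noncomputable def shiftMap : Module.End ℂ (hardySpace →L[ℂ] hardySpace) where
  toFun X := ContinuousLinearMap.adjoint shift * X * shift
  map_add' X Y := by rw [mul_add, add_mul]
  map_smul' c X := by simp

theorem coeFn_coordFun : coordFun =ᵐ[circleHaar] fun z : Circle => (z : ℂ) :=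
  ContinuousMap.coeFn_toLp circleHaar ⟨fun z : Circle => (z : ℂ), by fun_prop⟩

theorem star_coordFun_mul : star coordFun * coordFun = 1 := by
  apply Lp.ext
  filter_upwards [CircleLInf.coeFn_mul (star coordFun) coordFun, CircleLInf.coeFn_one,
    Lp.coeFn_star coordFun, coeFn_coordFun] with z h1 h2 h3 h4
  rw [h1, h2, h3, Pi.star_apply, h4]
  simp [← Complex.normSq_eq_conj_mul_self]

theorem mulOp_coordFun_mem_unitary : mulOp coordFun ∈ unitary (CircleL2 →L[ℂ] CircleL2) := by
  change mulRep coordFun ∈ _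
  refine ⟨?_, ?_⟩ <;> rw [← map_star, ← map_mul]
  · rw [star_coordFun_mul, map_one]
  · rw [mul_comm, star_coordFun_mul, map_one]

/-- The automorphism `θ(Z) = U* Z U` of `B(L²(𝕋))`, where `U = M_z`. -/
noncomputable def shiftDilation :
    (fullVonNeumannAlgebra CircleL2).toStarSubalgebra →⋆ₐ[ℂ]
      (fullVonNeumannAlgebra CircleL2).toStarSubalgebra where
  toFun Z := ⟨star (mulOp coordFun) * Z.1 * mulOp coordFun, trivial⟩
  map_one' := by
    ext1
    change star (mulOp coordFun) * 1 * mulOp coordFun = 1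
    rw [mul_one, Unitary.star_mul_self_of_mem mulOp_coordFun_mem_unitary]
  map_mul' Y Z := by
    ext1
    change star (mulOp coordFun) * (Y.1 * Z.1) * mulOp coordFun =
      star (mulOp coordFun) * Y.1 * mulOp coordFun * (star (mulOp coordFun) * Z.1 * mulOp coordFun)
    rw [show star (mulOp coordFun) * Y.1 * mulOp coordFun *
        (star (mulOp coordFun) * Z.1 * mulOp coordFun) =
        star (mulOp coordFun) * Y.1 * (mulOp coordFun * star (mulOp coordFun)) * Z.1 *
          mulOp coordFun by simp only [mul_assoc],
      Unitary.mul_star_self_of_mem mulOp_coordFun_mem_unitary, mul_one]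
    simp only [mul_assoc]
  map_zero' := by
    ext1
    change star (mulOp coordFun) * 0 * mulOp coordFun = 0
    rw [mul_zero, zero_mul]
  map_add' Y Z := by
    ext1
    change star (mulOp coordFun) * (Y.1 + Z.1) * mulOp coordFun =
      star (mulOp coordFun) * Y.1 * mulOp coordFun + star (mulOp coordFun) * Z.1 * mulOp coordFun
    rw [mul_add, add_mul]
  commutes' c := by
    ext1
    change star (mulOp coordFun) * algebraMap ℂ (CircleL2 →L[ℂ] CircleL2) c * mulOp coordFun =
      algebraMap ℂ (CircleL2 →L[ℂ] CircleL2) c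
    rw [← Algebra.commutes, mul_assoc,
      Unitary.star_mul_self_of_mem mulOp_coordFun_mem_unitary, mul_one]
  map_star' Z := by
    ext1
    change star (mulOp coordFun) * star Z.1 * mulOp coordFun =
      star (star (mulOp coordFun) * Z.1 * mulOp coordFun)
    rw [star_mul, star_mul, star_star, mul_assoc]

end Toeplitz

/-! Let p be the projection of K onto H and q_n = θⁿ(p). Since τ is unital, the q_n increase, and
minimality of K makes them tend strongly to 1. Moreover q_n θⁿ(b) q_n = θⁿ(pbp). Along a suitable
ultrafilter λⁿ → 1 for all λ ∈ 𝕋 at once, so θⁿ(b) → b in norm for b in the peripheral space, and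
therefore b is the strong limit of θⁿ(pbp). This formula shows that compression is isometric
(`norm_compress`). It also shows that the compression of bc is the strong limit of τⁿ(xy), with x
and y the compressions of b and c; this expression involves τ alone, so the product does not depend
on the dilation (`poissonMul_compress_of_dilation`).

Conversely, if τ(x) = λx, then the operators λ⁻ⁿθⁿ(x) form a bounded martingale for the q_n, and
their strong limit is an eigenvector of θ that compresses to x (`exists_eigenvector`).

It remains to compute in one dilation. The unitary M_z extends S, which gives the dilation θ₀(Z) =
M_z* Z M_z. The equation θ₀(Z) = λZ means Z M_z = λ M_z Z. It holds for V_λ, so Z V_λ⁻¹ commutes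
with M_z and is a multiplication operator (`exists_eq_mulOp_of_commute`). Thus Z = M_f V_λ, its
compression is T_{λ,f}, and the product formula is the commutation rule V_λ M_g = M_{g(λ·)} V_λ. -/

open Filter Topology ContinuousLinearMap

/-! ### Compression to H and extension by zero -/

section Compression

variable {H : Type*} [NormedAddCommGroup H] [InnerProductSpace ℂ H] [CompleteSpace H]
variable {K : Type*} [NormedAddCommGroup K] [InnerProductSpace ℂ K] [CompleteSpace K]
variable (ι : H →ₗᵢ[ℂ] K)

theorem adjoint_isometry_apply_apply (h : H) : adjoint ι.toContinuousLinearMap (ι h) = h := by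
  have := (norm_map_iff_adjoint_comp_self ι.toContinuousLinearMap).mp ι.norm_map
  exact congr($this h)

theorem compress_apply (b : K →L[ℂ] K) (h : H) :
    compress ι b h = adjoint ι.toContinuousLinearMap (b (ι h)) := rfl

theorem inflate_apply (x : H →L[ℂ] H) (k : K) :
    inflate ι x k = ι (x (adjoint ι.toContinuousLinearMap k)) := rfl

theorem inflate_apply_isometry (x : H →L[ℂ] H) (h : H) : inflate ι x (ι h) = ι (x h) := by
  rw [inflate_apply, adjoint_isometry_apply_apply]

theorem compress_inflate (x : H →L[ℂ] H) : compress ι (inflate ι x) = x := by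
  ext1 h
  rw [compress_apply, inflate_apply_isometry, adjoint_isometry_apply_apply]

theorem inflate_mul (x y : H →L[ℂ] H) : inflate ι (x * y) = inflate ι x * inflate ι y := by
  ext1 k
  simp only [mul_apply_eq_comp, inflate_apply, adjoint_isometry_apply_apply]

theorem inflate_star (x : H →L[ℂ] H) : inflate ι (star x) = star (inflate ι x) := by
  simp only [star_eq_adjoint, inflate, adjoint_comp, adjoint_adjoint]
  rfl

theorem compress_star (b : K →L[ℂ] K) : compress ι (star b) = star (compress ι b) := by
  simp only [star_eq_adjoint, compress, adjoint_comp, adjoint_adjoint]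
  rfl

theorem compress_one : compress ι 1 = 1 := by
  ext1 h
  exact adjoint_isometry_apply_apply ι h

theorem inflate_compress (b : K →L[ℂ] K) :
    inflate ι (compress ι b) = inflate ι 1 * b * inflate ι 1 := rfl

theorem norm_adjoint_isometry_le : ‖adjoint ι.toContinuousLinearMap‖ ≤ 1 := by
  rw [LinearIsometryEquiv.norm_map]
  exact ι.norm_toContinuousLinearMap_le

/-- The compression as a linear map. -/
noncomputable def compressₗ : (K →L[ℂ] K) →ₗ[ℂ] (H →L[ℂ] H) where
  toFun := compress ι
  map_add' b c := by ext1 h; simp [compress_apply]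
  map_smul' z b := by ext1 h; simp [compress_apply]

theorem norm_compress_le (b : K →L[ℂ] K) : ‖compress ι b‖ ≤ ‖b‖ := by
  refine opNorm_le_bound _ (norm_nonneg _) fun h => ?_
  rw [compress_apply]
  refine (le_of_opNorm_le _ (norm_adjoint_isometry_le ι) _).trans ?_
  rw [one_mul, ← ι.norm_map h]
  exact b.le_opNorm _

theorem norm_inflate_le (x : H →L[ℂ] H) : ‖inflate ι x‖ ≤ ‖x‖ := by
  refine opNorm_le_bound _ (norm_nonneg _) fun k => ?_
  rw [inflate_apply, ι.norm_map]
  refine (x.le_opNorm _).trans ?_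
  gcongr
  simpa using le_of_opNorm_le _ (norm_adjoint_isometry_le ι) k

end Compression

/-! ### Simultaneous recurrence of the points of the circle -/

section Recurrence

/-- Along a suitable filter the powers of all points of the circle converge to one
simultaneously. -/
theorem Circle.exists_filter_tendsto_pow :
    ∃ F : Filter ℕ, F.NeBot ∧ F ≤ atTop ∧
      ∀ l : Circle, Tendsto (fun n : ℕ => (l : ℂ) ^ n) F (𝓝 1) := by
  -- The identity map is an element of the compact group `Circle → Circle`, and in a compact group 1
  -- is a cluster point of the powers of any element. No sequence n_k → ∞ could replace the
  -- ultrafilter: the functions z^{n_k} have integral zero, so by dominated convergence they cannot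
  -- tend to 1 everywhere.
  have h := mapClusterPt_one_atTop_pow (fun l : Circle => l)
  obtain ⟨U, hU, hU'⟩ := mapClusterPt_iff_ultrafilter.mp h
  refine ⟨U, inferInstance, hU, fun l => ?_⟩
  have h1 := (tendsto_pi_nhds.mp hU') l
  exact ((continuous_subtype_val.tendsto (1 : Circle)).comp h1).congr fun n => Circle.coe_pow l n

end Recurrence

/-! ### Von Neumann algebras and limits of operators -/

namespace VonNeumannAlgebra

variable {K : Type*} [NormedAddCommGroup K] [InnerProductSpace ℂ K] [CompleteSpace K]

theorem isClosed (B : VonNeumannAlgebra K) :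
    IsClosed (B.toStarSubalgebra : Set (K →L[ℂ] K)) := by
  rw [coe_toStarSubalgebra, ← centralizer_centralizer]
  exact Set.isClosed_centralizer _

instance instCompleteSpace (B : VonNeumannAlgebra K) : CompleteSpace B.toStarSubalgebra :=
  B.isClosed.completeSpace_coe

/-- A von Neumann algebra is closed under pointwise limits. -/
theorem mem_of_tendsto (B : VonNeumannAlgebra K) {α : Type*} {F : Filter α} [F.NeBot]
    {a : α → K →L[ℂ] K} {b : K →L[ℂ] K} (ha : ∀ n, a n ∈ B.toStarSubalgebra)
    (h : ∀ k, Tendsto (fun n => a n k) F (𝓝 (b k))) : b ∈ B.toStarSubalgebra := by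
  change b ∈ (B : Set (K →L[ℂ] K))
  rw [← centralizer_centralizer]
  intro y hy
  ext1 k
  have h1 : Tendsto (fun n => y (a n k)) F (𝓝 (y (b k))) := (y.continuous.tendsto _).comp (h k)
  refine tendsto_nhds_unique h1 ((h (y k)).congr fun n => ?_)
  exact congr($(hy (a n) (ha n)) k)

theorem norm_map_le {B : VonNeumannAlgebra K}
    (θ : B.toStarSubalgebra →⋆ₐ[ℂ] B.toStarSubalgebra) (b : B.toStarSubalgebra) :
    ‖θ b‖ ≤ ‖b‖ := by
  have := B.isClosed
  exact NonUnitalStarAlgHom.norm_apply_le θ b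

end VonNeumannAlgebra

section PointwiseLimits

variable {α V W : Type*} [NormedAddCommGroup V] [NormedSpace ℂ V] [NormedAddCommGroup W]
  [NormedSpace ℂ W]

/-- The vectors on which the linear maps `a n` converge to `b`. -/
def tendstoSubmodule (a : α → V →ₗ[ℂ] W) (b : V →ₗ[ℂ] W) (F : Filter α) : Submodule ℂ V where
  carrier := {v | Tendsto (fun n => a n v) F (𝓝 (b v))}
  add_mem' {v w} hv hw := by
    simpa using! Tendsto.add (M := W) hv hw
  zero_mem' := by simp [tendsto_const_nhds]
  smul_mem' c v hv := by
    simpa using! Tendsto.const_smul (M := ℂ) (α := W) hv c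

/-- Contractivity makes pointwise convergence pass to norm closures. This carries limits from
eigenvectors to the peripheral space, and from words to all of K. -/
theorem isClosed_tendstoSubmodule {a : α → V →ₗ[ℂ] W} {b : V →ₗ[ℂ] W} {F : Filter α}
    (ha : ∀ n v, ‖a n v‖ ≤ ‖v‖) (hb : ∀ v, ‖b v‖ ≤ ‖v‖) :
    IsClosed (tendstoSubmodule a b F : Set V) := by
  refine isClosed_of_closure_subset fun v hv => ?_
  refine Metric.tendsto_nhds.mpr fun ε hε => ?_
  obtain ⟨w, hw, hvw⟩ := Metric.mem_closure_iff.mp hv (ε / 3) (by positivity)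
  filter_upwards [Metric.tendsto_nhds.mp hw (ε / 3) (by positivity)] with n hn
  have h1 : dist (a n v) (a n w) ≤ dist v w := by
    rw [dist_eq_norm, dist_eq_norm, ← map_sub]
    exact ha n _
  have h2 : dist (b w) (b v) ≤ dist v w := by
    rw [dist_comm, dist_eq_norm, dist_eq_norm, ← map_sub]
    exact hb _
  linarith [dist_triangle4 (a n v) (a n w) (b w) (b v)]

/-- Composition is strongly continuous on bounded sets. -/
theorem tendsto_comp_apply {a c : α → V →L[ℂ] V} {b d : V →L[ℂ] V} {F : Filter α} {C : ℝ}
    (ha : ∀ n, ‖a n‖ ≤ C) (hab : ∀ v, Tendsto (fun n => a n v) F (𝓝 (b v)))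
    (hcd : ∀ v, Tendsto (fun n => c n v) F (𝓝 (d v))) (v : V) :
    Tendsto (fun n => (a n * c n) v) F (𝓝 ((b * d) v)) := by
  have h1 : Tendsto (fun n => a n (c n v - d v)) F (𝓝 0) := by
    refine squeeze_zero_norm (fun n => (a n).le_of_opNorm_le (ha n) _) ?_
    simpa using! ((tendsto_sub_nhds_zero_iff.mpr (hcd v)).norm.const_mul C)
  simpa using! h1.add (hab (d v))

end PointwiseLimits

section Eigenvectors

variable {V W : Type*} [NormedAddCommGroup V] [NormedSpace ℂ V] [NormedAddCommGroup W]
  [NormedSpace ℂ W]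

theorem eigenspace_le_peripheralSpace (T : Module.End ℂ V) (l : Circle) :
    Module.End.eigenspace T (l : ℂ) ≤ peripheralSpace T :=
  (le_iSup (fun l : Circle => Module.End.eigenspace T (l : ℂ)) l).trans
    (Submodule.le_topologicalClosure _)

theorem peripheralSpace_le {T : Module.End ℂ V} {S : Submodule ℂ V} (hS : IsClosed (S : Set V))
    (h : ∀ l : Circle, Module.End.eigenspace T (l : ℂ) ≤ S) : peripheralSpace T ≤ S :=
  Submodule.topologicalClosure_minimal _ (iSup_le h) hS

theorem isClosed_peripheralSpace (T : Module.End ℂ V) :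
    IsClosed (peripheralSpace T : Set V) :=
  Submodule.isClosed_topologicalClosure _

end Eigenvectors

/-! ### The projections θⁿ(p) and the recovery of peripheral elements from their compressions -/

namespace IsMinimalDilation

variable {H : Type*} [NormedAddCommGroup H] [InnerProductSpace ℂ H] [CompleteSpace H]
variable {K : Type*} [NormedAddCommGroup K] [InnerProductSpace ℂ K] [CompleteSpace K]
variable {τ : Module.End ℂ (H →L[ℂ] H)} {ι : H →ₗᵢ[ℂ] K} {B : VonNeumannAlgebra K}
  {θ : B.toStarSubalgebra →⋆ₐ[ℂ] B.toStarSubalgebra}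

theorem norm_iterate_le (θ : B.toStarSubalgebra →⋆ₐ[ℂ] B.toStarSubalgebra) (n : ℕ)
    (b : B.toStarSubalgebra) : ‖θ^[n] b‖ ≤ ‖b‖ := by
  induction n with
  | zero => simp
  | succ n ih =>
    rw [Function.iterate_succ_apply']
    exact (VonNeumannAlgebra.norm_map_le θ _).trans ih

theorem mem_eigenspace_iff {b : B.toStarSubalgebra} {c : ℂ} :
    b ∈ Module.End.eigenspace (θ.toAlgHom.toLinearMap : Module.End ℂ B.toStarSubalgebra) c ↔
      θ b = c • b :=
  Module.End.mem_eigenspace_iff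

theorem iterate_map_smul (c : ℂ) (b : B.toStarSubalgebra) (n : ℕ) :
    θ^[n] (c • b) = c • θ^[n] b := by
  induction n with
  | zero => rfl
  | succ n ih => rw [Function.iterate_succ_apply', ih, map_smul, Function.iterate_succ_apply']

theorem iterate_map_star (b : B.toStarSubalgebra) (n : ℕ) :
    θ^[n] (star b) = star (θ^[n] b) := by
  induction n with
  | zero => rfl
  | succ n ih => rw [Function.iterate_succ_apply', ih, map_star, Function.iterate_succ_apply']

theorem iterate_eq_of_eigenvector {b : B.toStarSubalgebra} {c : ℂ} (h : θ b = c • b) (n : ℕ) :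
    θ^[n] b = c ^ n • b := by
  induction n with
  | zero => simp
  | succ n ih => rw [Function.iterate_succ_apply', ih, map_smul, h, smul_smul, pow_succ]

/-- The endomorphism of a dilation is asymptotically trivial on the peripheral space, along a
filter that makes the powers of all points of the circle converge to one. -/
theorem tendsto_iterate {F : Filter ℕ}
    (hF : ∀ l : Circle, Tendsto (fun n : ℕ => (l : ℂ) ^ n) F (𝓝 1))
    {b : B.toStarSubalgebra} (hb : b ∈ dilationPeripheralSpace θ) :
    Tendsto (fun n => θ^[n] b) F (𝓝 b) := by
  let a : ℕ → B.toStarSubalgebra →ₗ[ℂ] B.toStarSubalgebra := fun n =>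
    (θ.toAlgHom.toLinearMap : Module.End ℂ B.toStarSubalgebra) ^ n
  have ha : ∀ n c, a n c = θ^[n] c := fun n c => Module.End.pow_apply _ _ _
  have h : dilationPeripheralSpace θ ≤ tendstoSubmodule a LinearMap.id F := by
    refine peripheralSpace_le (isClosed_tendstoSubmodule (fun n v => ?_) fun v => le_rfl) ?_
    · rw [ha]
      exact norm_iterate_le θ n v
    · intro l c hc
      change Tendsto (fun n => a n c) F (𝓝 c)
      simp only [ha, iterate_eq_of_eigenvector (mem_eigenspace_iff.mp hc)]
      simpa using (hF l).smul_const c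
  exact Tendsto.congr (ha · b) (h hb)

variable (hD : IsMinimalDilation τ ι B θ)

/-- The inclusion `B(H) ⊆ B`. -/
noncomputable def embed (x : H →L[ℂ] H) : B.toStarSubalgebra := ⟨inflate ι x, hD.inflate_mem x⟩

theorem coe_embed (x : H →L[ℂ] H) : (hD.embed x : K →L[ℂ] K) = inflate ι x := rfl

theorem compress_iterate_embed (n : ℕ) (x : H →L[ℂ] H) :
    compress ι (θ^[n] (hD.embed x) : B.toStarSubalgebra).1 = (τ ^ n) x :=
  (hD.dilation n x).symm

theorem embed_mul (x y : H →L[ℂ] H) : hD.embed (x * y) = hD.embed x * hD.embed y :=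
  Subtype.ext (inflate_mul ι x y)

theorem embed_one_mul (x : H →L[ℂ] H) : hD.embed 1 * hD.embed x = hD.embed x := by
  rw [← embed_mul, one_mul]

theorem star_embed_one : star (hD.embed 1) = hD.embed 1 := by
  refine Subtype.ext ?_
  change star (inflate ι 1) = inflate ι 1
  rw [← inflate_star, star_one]

theorem embed_smul (c : ℂ) (x : H →L[ℂ] H) : hD.embed (c • x) = c • hD.embed x := by
  refine Subtype.ext ?_
  ext1 k
  change inflate ι (c • x) k = c • inflate ι x k
  simp [inflate_apply]

theorem embed_compress (b : B.toStarSubalgebra) :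
    hD.embed (compress ι b.1) = hD.embed 1 * b * hD.embed 1 :=
  Subtype.ext (inflate_compress ι b.1)

theorem norm_embed_le (x : H →L[ℂ] H) : ‖hD.embed x‖ ≤ ‖x‖ := norm_inflate_le ι x

theorem norm_iterate_embed_le (n : ℕ) (x : H →L[ℂ] H) : ‖θ^[n] (hD.embed x)‖ ≤ ‖x‖ :=
  (norm_iterate_le θ n _).trans (hD.norm_embed_le x)

/-- The projection `θⁿ(p)`, where `p` is the projection of `K` onto `H`. -/
noncomputable def proj (n : ℕ) : B.toStarSubalgebra := θ^[n] (hD.embed 1)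

theorem proj_zero : hD.proj 0 = hD.embed 1 := rfl

theorem map_proj (n : ℕ) : θ (hD.proj n) = hD.proj (n + 1) :=
  (Function.iterate_succ_apply' θ n _).symm

theorem iterate_proj (m n : ℕ) : θ^[n] (hD.proj m) = hD.proj (n + m) :=
  (Function.iterate_add_apply θ n m _).symm

theorem star_proj (n : ℕ) : star (hD.proj n) = hD.proj n := by
  rw [proj, ← iterate_map_star, star_embed_one]

theorem norm_proj_le (n : ℕ) : ‖hD.proj n‖ ≤ 1 :=
  (hD.norm_iterate_embed_le n 1).trans ContinuousLinearMap.norm_id_le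

theorem proj_mul_iterate_embed (n : ℕ) (x : H →L[ℂ] H) :
    hD.proj n * θ^[n] (hD.embed x) = θ^[n] (hD.embed x) := by
  rw [proj, ← iterate_map_mul, embed_one_mul]

theorem proj_mul_self (n : ℕ) : hD.proj n * hD.proj n = hD.proj n :=
  hD.proj_mul_iterate_embed n 1

/-- Both sides are θⁿ(pbp). This is how information about a compression to H returns to the
dilation. -/
theorem proj_mul_iterate_mul_proj (n : ℕ) (b : B.toStarSubalgebra) :
    hD.proj n * θ^[n] b * hD.proj n = θ^[n] (hD.embed (compress ι b.1)) := by
  rw [embed_compress, iterate_map_mul, iterate_map_mul, proj]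

/-- Unitality of τ gives p q₁ p = p, hence (p − q₁p)*(p − q₁p) = p − p q₁ p = 0 and q₁p = p.
Applying θⁿ gives q_{n+1} q_n = q_n, and induction does the rest. -/
theorem proj_mul_of_le (hτ : τ 1 = 1) {m n : ℕ} (h : m ≤ n) :
    hD.proj n * hD.proj m = hD.proj m := by
  have h1 : hD.proj 1 * hD.proj 0 = hD.proj 0 := by
    have h2 : hD.proj 0 * hD.proj 1 * hD.proj 0 = hD.proj 0 := by
      have h3 := hD.embed_compress (hD.proj 1)
      rw [proj, hD.compress_iterate_embed, pow_one, hτ] at h3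
      exact h3.symm
    have h4 : star (hD.proj 0 - hD.proj 1 * hD.proj 0) *
        (hD.proj 0 - hD.proj 1 * hD.proj 0) = 0 := by
      rw [star_sub, star_mul, star_proj, star_proj, sub_mul, mul_sub, mul_sub, proj_mul_self,
        ← mul_assoc, h2, mul_assoc, ← mul_assoc (hD.proj 1), proj_mul_self, ← mul_assoc, h2,
        sub_self]
    have h5 := congr($h4.1)
    have h6 : (hD.proj 0 - hD.proj 1 * hD.proj 0 : B.toStarSubalgebra).1 = 0 :=
      (CStarRing.star_mul_self_eq_zero_iff _).mp h5
    exact (sub_eq_zero.mp (Subtype.ext h6)).symm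
  induction n, h using Nat.le_induction with
  | base => exact hD.proj_mul_self m
  | succ n hmn ih =>
    have h2 : hD.proj (n + 1) * hD.proj n = hD.proj n := by
      have := congr(θ^[n] $h1)
      rwa [iterate_map_mul, iterate_proj, iterate_proj] at this
    rw [← ih, ← mul_assoc, h2]

theorem mul_proj_of_le (hτ : τ 1 = 1) {m n : ℕ} (h : m ≤ n) :
    hD.proj m * hD.proj n = hD.proj m := by
  have := congr(star $(hD.proj_mul_of_le hτ h))
  rwa [star_mul, star_proj, star_proj] at this

theorem proj_dilationWord (x : ℕ → (H →L[ℂ] H)) (h : H) (n : ℕ) :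
    (hD.proj n).1 (dilationWord hD.inflate_mem θ x h n) =
      dilationWord hD.inflate_mem θ x h n := by
  cases n with
  | zero => exact inflate_apply_isometry ι 1 h
  | succ n =>
    exact congr(($(hD.proj_mul_iterate_embed (n + 1) (x (n + 1)))).1
      (dilationWord hD.inflate_mem θ x h n))

/-- A word of length n lies in the range of q_n, so it is fixed by every q_m with m ≥ n; such words
span a dense subspace. -/
theorem tendsto_proj (hτ : τ 1 = 1) (k : K) :
    Tendsto (fun n => (hD.proj n).1 k) atTop (𝓝 k) := by
  let a : ℕ → K →ₗ[ℂ] K := fun n => (hD.proj n).1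
  have h : (⊤ : Submodule ℂ K) ≤ tendstoSubmodule a LinearMap.id atTop := by
    rw [← hD.minimal_space]
    refine Submodule.topologicalClosure_minimal _ (Submodule.span_le.mpr ?_)
      (isClosed_tendstoSubmodule (fun n v => ?_) fun v => le_rfl)
    · rintro _ ⟨n, x, h, rfl⟩
      refine tendsto_const_nhds.congr' ?_
      filter_upwards [eventually_ge_atTop n] with m hm
      have := congr(($(hD.proj_mul_of_le hτ hm)).1 (dilationWord hD.inflate_mem θ x h n))
      change (hD.proj m).1 ((hD.proj n).1 _) = _ at this
      rw [proj_dilationWord] at this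
      exact this.symm
    · simpa only [one_mul] using! (hD.proj n).1.le_of_opNorm_le (hD.norm_proj_le n) v
  exact h (Submodule.mem_top (x := k))

/-- Operators that converge strongly keep their limit when they are compressed by the
projections `θⁿ(p)`. -/
theorem tendsto_proj_mul_mul_proj (hτ : τ 1 = 1) {F : Filter ℕ} (hF : F ≤ atTop)
    {a : ℕ → B.toStarSubalgebra} {b : K →L[ℂ] K} {C : ℝ} (ha : ∀ n, ‖a n‖ ≤ C)
    (hab : ∀ k, Tendsto (fun n => (a n).1 k) F (𝓝 (b k))) (k : K) :
    Tendsto (fun n => (hD.proj n * a n * hD.proj n).1 k) F (𝓝 (b k)) := by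
  have h1 := tendsto_comp_apply (a := fun n => (a n).1) (c := fun n => (hD.proj n).1) (d := 1)
    ha hab (fun v => (hD.tendsto_proj hτ v).mono_left hF)
  have h2 := tendsto_comp_apply (a := fun n => (hD.proj n).1) (b := 1) hD.norm_proj_le
    (fun v => (hD.tendsto_proj hτ v).mono_left hF) h1 k
  rw [one_mul, mul_one] at h2
  exact h2.congr fun n => congr(($(mul_assoc (hD.proj n) (a n) (hD.proj n))).1 k).symm

theorem eq_of_proj_mul_mul_proj_eq (hτ : τ 1 = 1) {b c : B.toStarSubalgebra}
    (h : ∀ᶠ n in atTop, hD.proj n * b * hD.proj n = hD.proj n * c * hD.proj n) : b = c := by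
  refine Subtype.ext (ContinuousLinearMap.ext fun k => ?_)
  refine tendsto_nhds_unique (hD.tendsto_proj_mul_mul_proj hτ le_rfl (a := fun _ => b)
    (fun _ => le_rfl) (fun _ => tendsto_const_nhds) k) ?_
  refine (hD.tendsto_proj_mul_mul_proj hτ le_rfl (a := fun _ => c)
    (fun _ => le_rfl) (fun _ => tendsto_const_nhds) k).congr' ?_
  filter_upwards [h] with n hn
  rw [hn]

/-- The compression is isometric on the peripheral space. -/
theorem norm_compress (hD : IsMinimalDilation τ ι B θ) (hτ : τ 1 = 1) {b : B.toStarSubalgebra}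
    (hb : b ∈ dilationPeripheralSpace θ) : ‖compress ι b.1‖ = ‖b.1‖ := by
  refine le_antisymm (norm_compress_le ι b.1) ?_
  obtain ⟨F, hF, hF', hF1⟩ := Circle.exists_filter_tendsto_pow
  have h1 := ((continuous_subtype_val.tendsto b).comp (tendsto_iterate hF1 hb))
  refine opNorm_le_bound _ (norm_nonneg _) fun k => ?_
  -- As θⁿ(b) → b along `F` and q_n → 1 strongly, bk is the limit of q_n θⁿ(b) q_n k = θⁿ(pbp)k,
  -- whose norm is at most ‖pbp‖‖k‖.
  refine le_of_tendsto (hD.tendsto_proj_mul_mul_proj hτ hF' (norm_iterate_le θ · b)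
    (fun v => (ContinuousLinearMap.apply ℂ K v).continuous.tendsto _ |>.comp h1) k).norm
    (Eventually.of_forall fun n => ?_)
  rw [proj_mul_iterate_mul_proj]
  exact le_of_opNorm_le _ (hD.norm_iterate_embed_le n _) k

/-- The compression of a product of elements of the peripheral space depends only on their
compressions. -/
theorem tendsto_pow_compress_mul_compress (hD : IsMinimalDilation τ ι B θ) (hτ : τ 1 = 1)
    {F : Filter ℕ} (hF : F ≤ atTop)
    (hF1 : ∀ l : Circle, Tendsto (fun n : ℕ => (l : ℂ) ^ n) F (𝓝 1)) {b c : B.toStarSubalgebra}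
    (hb : b ∈ dilationPeripheralSpace θ) (hc : c ∈ dilationPeripheralSpace θ) (h : H) :
    Tendsto (fun n => (τ ^ n) (compress ι b.1 * compress ι c.1) h) F
      (𝓝 (compress ι (b * c).1 h)) := by
  have hs : ∀ {b : B.toStarSubalgebra}, b ∈ dilationPeripheralSpace θ → ∀ k, Tendsto
      (fun n => (hD.proj n * θ^[n] b * hD.proj n).1 k) F (𝓝 (b.1 k)) := fun {b} hb k =>
    hD.tendsto_proj_mul_mul_proj hτ hF (norm_iterate_le θ · b)
      (fun v => (ContinuousLinearMap.apply ℂ K v).continuous.tendsto _ |>.comp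
        ((continuous_subtype_val.tendsto b).comp (tendsto_iterate hF1 hb))) k
  simp only [proj_mul_iterate_mul_proj] at hs
  have h1 := tendsto_comp_apply (fun n => hD.norm_iterate_embed_le n (compress ι b.1)) (hs hb)
    (hs hc) (ι h)
  -- The factors θⁿ(pbp) and θⁿ(pcp) multiply to θⁿ(pbp·pcp), and compression turns θⁿ into τⁿ.
  refine (((adjoint ι.toContinuousLinearMap).continuous.tendsto _).comp h1).congr fun n => ?_
  rw [← hD.compress_iterate_embed, embed_mul, iterate_map_mul]
  rfl

end IsMinimalDilation

/-! ### Lifting eigenvectors of τ to the dilation -/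

theorem norm_sub_sq_of_proj {K : Type*} [NormedAddCommGroup K] [InnerProductSpace ℂ K]
    [CompleteSpace K] {q : K →L[ℂ] K} (h1 : star q = q) (h2 : q * q = q) (u : K) :
    ‖u - q u‖ ^ 2 = ‖u‖ ^ 2 - ‖q u‖ ^ 2 := by
  have h3 : inner ℂ u (q u) = inner ℂ (q u) (q u) := by
    rw [← adjoint_inner_right q, ← star_eq_adjoint, h1, ← mul_apply_eq_comp, h2]
  rw [@norm_sub_sq ℂ, h3, inner_self_eq_norm_sq]
  ring

namespace IsMinimalDilation

variable {H : Type*} [NormedAddCommGroup H] [InnerProductSpace ℂ H] [CompleteSpace H]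
variable {K : Type*} [NormedAddCommGroup K] [InnerProductSpace ℂ K] [CompleteSpace K]
variable {τ : Module.End ℂ (H →L[ℂ] H)} {ι : H →ₗᵢ[ℂ] K} {B : VonNeumannAlgebra K}
  {θ : B.toStarSubalgebra →⋆ₐ[ℂ] B.toStarSubalgebra} (hD : IsMinimalDilation τ ι B θ)

/-- Bounded sequences in `B` that are compatible with the projections `θⁿ(p)` converge strongly
on the ranges of these projections. -/
theorem exists_tendsto_apply_proj {a : ℕ → B.toStarSubalgebra} {C : ℝ}
    (hτ : τ 1 = 1) (ha : ∀ n, ‖a n‖ ≤ C) (hq : ∀ m n, m ≤ n → hD.proj m * a n * hD.proj m = a m)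
    (m : ℕ) (v : K) : ∃ u, Tendsto (fun n => (a n).1 ((hD.proj m).1 v)) atTop (𝓝 u) := by
  set w := (hD.proj m).1 v with hw
  have hC : 0 ≤ C := (norm_nonneg _).trans (ha 0)
  -- The martingale property: w lies in the range of q_m ≤ q_k, so q_k a_n w = q_k a_n q_k w = a_k
  -- w. Pythagoras then makes ‖a_n w‖² increase by exactly ‖a_n w − a_k w‖², and a bounded
  -- increasing sequence is Cauchy.
  have h1 : ∀ k n, m ≤ k → k ≤ n → (hD.proj k).1 ((a n).1 w) = (a k).1 w := by
    intro k n hmk hkn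
    have h2 : hD.proj k * a n * hD.proj m = a k * hD.proj m := by
      rw [← hq k n hkn, mul_assoc _ (hD.proj k) (hD.proj m), hD.proj_mul_of_le hτ hmk]
    exact congr(($h2).1 v)
  have h2 : ∀ k n, m ≤ k → k ≤ n →
      ‖(a n).1 w - (a k).1 w‖ ^ 2 = ‖(a n).1 w‖ ^ 2 - ‖(a k).1 w‖ ^ 2 := by
    intro k n hmk hkn
    rw [← h1 k n hmk hkn]
    exact norm_sub_sq_of_proj congr(($(hD.star_proj k)).1) congr(($(hD.proj_mul_self k)).1) _
  have hmono : Monotone fun n => ‖(a (n + m)).1 w‖ ^ 2 := by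
    intro k n hkn
    have := h2 (k + m) (n + m) (by omega) (by omega)
    nlinarith [sq_nonneg ‖(a (n + m)).1 w - (a (k + m)).1 w‖]
  have hbdd : BddAbove (Set.range fun n => ‖(a (n + m)).1 w‖ ^ 2) := by
    refine ⟨(C * ‖w‖) ^ 2, ?_⟩
    rintro _ ⟨n, rfl⟩
    exact pow_le_pow_left₀ (norm_nonneg _) (le_of_opNorm_le _ (ha _) w) 2
  have hcau : CauchySeq fun n => (a (n + m)).1 w := by
    refine Metric.cauchySeq_iff'.mpr fun ε hε => ?_
    obtain ⟨N, hN⟩ := Metric.cauchySeq_iff'.mp (tendsto_atTop_ciSup hmono hbdd).cauchySeq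
      (ε ^ 2) (by positivity)
    refine ⟨N, fun n hn => ?_⟩
    have h3 := (le_abs_self _).trans_lt (Real.dist_eq _ _ ▸ hN n hn)
    rw [← h2 (N + m) (n + m) (by omega) (by omega)] at h3
    rw [dist_eq_norm]
    exact lt_of_pow_lt_pow_left₀ 2 hε.le h3
  obtain ⟨u, hu⟩ := cauchySeq_tendsto_of_complete hcau
  exact ⟨u, (tendsto_add_atTop_iff_nat (f := fun n => (a n).1 w) m).mp hu⟩

/-- Bounded sequences in `B` that are compatible with the projections `θⁿ(p)` converge
strongly. -/
theorem exists_tendsto_apply {a : ℕ → B.toStarSubalgebra} {C : ℝ}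
    (hτ : τ 1 = 1) (ha : ∀ n, ‖a n‖ ≤ C) (hq : ∀ m n, m ≤ n → hD.proj m * a n * hD.proj m = a m) :
    ∃ b : B.toStarSubalgebra, ∀ v, Tendsto (fun n => (a n).1 v) atTop (𝓝 (b.1 v)) := by
  have hC : 0 ≤ C := (norm_nonneg _).trans (ha 0)
  have hcau : ∀ v, CauchySeq fun n => (a n).1 v := by
    intro v
    refine Metric.cauchySeq_iff'.mpr fun ε hε => ?_
    -- Replacing v by q_m v costs at most C‖q_m v − v‖ uniformly in n, so one large m settles all n.
    have h1 : Tendsto (fun m => C * ‖(hD.proj m).1 v - v‖) atTop (𝓝 0) := by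
      simpa using! (tendsto_sub_nhds_zero_iff.mpr (hD.tendsto_proj hτ v)).norm.const_mul C
    obtain ⟨m, hm⟩ := (h1.eventually (gt_mem_nhds (show 0 < ε / 3 by positivity))).exists
    obtain ⟨u, hu⟩ := hD.exists_tendsto_apply_proj hτ ha hq m v
    obtain ⟨N, hN⟩ := Metric.cauchySeq_iff'.mp hu.cauchySeq (ε / 3) (by positivity)
    refine ⟨N, fun n hn => ?_⟩
    have h2 : ∀ n, dist ((a n).1 ((hD.proj m).1 v)) ((a n).1 v) < ε / 3 := fun n => by
      rw [dist_eq_norm, ← map_sub]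
      exact (le_of_opNorm_le _ (ha n) _).trans_lt hm
    have h3 := h2 n
    rw [dist_comm] at h3
    linarith [dist_triangle4 ((a n).1 v) ((a n).1 ((hD.proj m).1 v)) ((a N).1 ((hD.proj m).1 v))
      ((a N).1 v), hN n hn, h2 N]
  choose f hf using fun v => cauchySeq_tendsto_of_complete (hcau v)
  let b : K →L[ℂ] K := continuousLinearMapOfTendsto (fun n => (a n).1) (tendsto_pi_nhds.mpr hf)
  exact ⟨⟨b, B.mem_of_tendsto (fun n => (a n).2) hf⟩, hf⟩

/-- Peripheral eigenvectors of `τ` are compressions of eigenvectors of `θ`. -/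
theorem exists_eigenvector (hD : IsMinimalDilation τ ι B θ) (hτ : τ 1 = 1) {l : Circle}
    {x : H →L[ℂ] H}   (hx : τ x = (l : ℂ) • x) :
    ∃ b : B.toStarSubalgebra, θ b = (l : ℂ) • b ∧ compress ι b.1 = x := by
  have hl : (l : ℂ) ≠ 0 := l.coe_ne_zero
  let a : ℕ → B.toStarSubalgebra := fun n => ((l : ℂ)⁻¹ ^ n) • θ^[n] (hD.embed x)
  have hpow : ∀ n : ℕ, (τ ^ n) x = (l : ℂ) ^ n • x := by
    intro n
    induction n with
    | zero => simp
    | succ n ih => rw [pow_succ', Module.End.mul_apply, ih, map_smul, hx, smul_smul, pow_succ]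
  have ha : ∀ n, ‖a n‖ ≤ ‖x‖ := fun n => by
    rw [norm_smul]
    simpa only [norm_pow, norm_inv, Circle.norm_coe, inv_one, one_pow, one_mul] using
      hD.norm_iterate_embed_le n x
  -- For n = m + k, q_m θⁿ(x) q_m = θᵐ(p θᵏ(x) p) = θᵐ(τᵏ(x)) = λᵏ θᵐ(x); the factor λ⁻ⁿ compensates
  -- λᵏ.
  have hq : ∀ m n, m ≤ n → hD.proj m * a n * hD.proj m = a m := by
    intro m n hmn
    obtain ⟨k, rfl⟩ := Nat.exists_eq_add_of_le hmn
    simp only [a]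
    rw [mul_smul_comm, smul_mul_assoc, Function.iterate_add_apply, proj_mul_iterate_mul_proj,
      compress_iterate_embed, hpow, embed_smul, iterate_map_smul, smul_smul, pow_add, mul_assoc,
      ← mul_pow, inv_mul_cancel₀ hl, one_pow, mul_one]
  obtain ⟨b, hb⟩ := hD.exists_tendsto_apply hτ ha hq
  have hqb : ∀ m, hD.proj m * b * hD.proj m = a m := by
    intro m
    refine Subtype.ext (ContinuousLinearMap.ext fun k => ?_)
    have h1 := ((hD.proj m).1.continuous.tendsto _).comp (hb ((hD.proj m).1 k))
    refine tendsto_nhds_unique h1 (tendsto_const_nhds.congr' ?_)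
    filter_upwards [eventually_ge_atTop m] with n hn
    exact congr(($(hq m n hn)).1 k).symm
  refine ⟨b, hD.eq_of_proj_mul_mul_proj_eq hτ ?_, ?_⟩
  -- For n = m + 1 the projection q_n is θ(q_m), so q_n θ(b) q_n = θ(q_m b q_m) = θ(a_m) = λ a_n =
  -- q_n (λb) q_n.
  · filter_upwards [eventually_ge_atTop 1] with n hn
    obtain ⟨m, rfl⟩ := Nat.exists_eq_add_of_le' hn
    rw [mul_smul_comm, smul_mul_assoc, hqb, ← map_proj, ← map_mul, ← map_mul, hqb]
    simp only [a]
    rw [map_smul, ← Function.iterate_succ_apply' θ, smul_smul, pow_succ', ← mul_assoc,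
      mul_inv_cancel₀ hl, one_mul]
  · have h1 := hqb 0
    rw [proj_zero, ← embed_compress] at h1
    have h2 := congr(compress ι ($h1).1)
    simpa [a, coe_embed, compress_inflate] using h2

/-- As p ≤ q₁, pθ(b)p = p q₁ θ(b) q₁ p = p θ(pbp) p, and the dilation property applies to pbp ∈
B(H). -/
theorem compress_map (hD : IsMinimalDilation τ ι B θ) (hτ : τ 1 = 1) (b : B.toStarSubalgebra) :
    compress ι (θ b).1 = τ (compress ι b.1) := by
  have h1 := hD.compress_iterate_embed 1 (compress ι b.1)
  rw [← proj_mul_iterate_mul_proj, pow_one, Function.iterate_one] at h1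
  rw [← h1, ← compress_inflate ι (compress ι (θ b).1),
    ← compress_inflate ι (compress ι (hD.proj 1 * θ b * hD.proj 1).1)]
  refine congrArg (fun b : B.toStarSubalgebra => compress ι b.1) (a₁ := hD.embed _)
    (a₂ := hD.embed _) ?_
  rw [embed_compress, embed_compress, ← hD.proj_zero,
    show hD.proj 0 * (hD.proj 1 * θ b * hD.proj 1) * hD.proj 0 =
      (hD.proj 0 * hD.proj 1) * θ b * (hD.proj 1 * hD.proj 0) by simp only [mul_assoc],
    hD.mul_proj_of_le hτ zero_le_one, hD.proj_mul_of_le hτ zero_le_one]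

/-- The compression of the eigenspaces of `θ` gives the eigenspaces of `τ`. -/
theorem image_eigenspace (hD : IsMinimalDilation τ ι B θ) (hτ : τ 1 = 1) (l : Circle) :
    (fun b : B.toStarSubalgebra => compress ι b.1) '' {b | θ b = (l : ℂ) • b} =
      Module.End.eigenspace τ (l : ℂ) := by
  ext x
  rw [SetLike.mem_coe, Module.End.mem_eigenspace_iff]
  constructor
  · rintro ⟨b, hb, rfl⟩
    rw [← hD.compress_map hτ, hb]
    exact (compressₗ ι).map_smul _ _
  · exact hD.exists_eigenvector hτ

/-- The compression of `B` to `H` as a continuous linear map. -/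
noncomputable def compressL (ι : H →ₗᵢ[ℂ] K) (B : VonNeumannAlgebra K) :
    B.toStarSubalgebra →L[ℂ] (H →L[ℂ] H) :=
  ((compressₗ ι).mkContinuous 1 fun b => by simpa only [one_mul] using! norm_compress_le ι b) ∘L
    B.toStarSubalgebra.toSubmodule.subtypeL

theorem bijOn_compress (hD : IsMinimalDilation τ ι B θ) (hτ : τ 1 = 1) :
    Set.BijOn (fun b : B.toStarSubalgebra => compress ι b.1)
      (dilationPeripheralSpace θ : Set B.toStarSubalgebra)
      (peripheralSpace τ : Set (H →L[ℂ] H)) := by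
  refine ⟨?_, ?_, ?_⟩
  · refine peripheralSpace_le (S := (peripheralSpace τ).comap (compressL ι B).toLinearMap)
      ((isClosed_peripheralSpace τ).preimage (compressL ι B).continuous) fun l b hb => ?_
    refine eigenspace_le_peripheralSpace τ l ?_
    rw [← SetLike.mem_coe, ← hD.image_eigenspace hτ]
    exact ⟨b, mem_eigenspace_iff.mp hb, rfl⟩
  · intro b hb c hc hbc
    have h1 := hD.norm_compress hτ (Submodule.sub_mem _ hb hc)
    have h2 : compress ι (b - c).1 = 0 := ((compressL ι B).map_sub b c).trans (sub_eq_zero.mpr hbc)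
    rw [h2, norm_zero] at h1
    exact sub_eq_zero.mp (Subtype.ext (norm_eq_zero.mp h1.symm))
  · have : CompleteSpace (dilationPeripheralSpace θ) :=
      (isClosed_peripheralSpace _).completeSpace_coe
    -- An isometry on a complete space has closed range, so surjectivity has to be checked on
    -- eigenvectors only.
    let T : dilationPeripheralSpace θ →ₗᵢ[ℂ] (H →L[ℂ] H) :=
      ⟨(compressL ι B).toLinearMap ∘ₗ (dilationPeripheralSpace θ).subtype,
        fun b => hD.norm_compress hτ b.2⟩
    have h : peripheralSpace τ ≤ LinearMap.range T.toLinearMap := by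
      refine peripheralSpace_le ?_ fun l x hx => ?_
      · exact T.isometry.isClosedEmbedding.isClosed_range
      · rw [← SetLike.mem_coe, ← hD.image_eigenspace hτ] at hx
        obtain ⟨b, hb, rfl⟩ := hx
        exact ⟨⟨b, eigenspace_le_peripheralSpace _ l (mem_eigenspace_iff.mpr hb)⟩, rfl⟩
    intro x hx
    obtain ⟨b, rfl⟩ := h hx
    exact ⟨b.1, b.2, rfl⟩

theorem poissonMul_compress (hD : IsMinimalDilation τ ι B θ) (hτ : τ 1 = 1)
    {b c : B.toStarSubalgebra} (hb : b ∈ dilationPeripheralSpace θ)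
    (hc : c ∈ dilationPeripheralSpace θ) :
    poissonMul ι θ (compress ι b.1) (compress ι c.1) = compress ι (b * c).1 := by
  have h := (hD.bijOn_compress hτ).injOn.leftInvOn_invFunOn
  have h1 : Function.invFunOn (fun b : B.toStarSubalgebra => compress ι b.1)
      (dilationPeripheralSpace θ : Set B.toStarSubalgebra) (compress ι b.1) = b := h hb
  have h2 : Function.invFunOn (fun b : B.toStarSubalgebra => compress ι b.1)
      (dilationPeripheralSpace θ : Set B.toStarSubalgebra) (compress ι c.1) = c := h hc
  simp only [poissonMul]
  rw [h1, h2]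

/-- The product of the peripheral Poisson boundary does not depend on the dilation. -/
theorem poissonMul_compress_of_dilation {K' : Type*} [NormedAddCommGroup K']
    [InnerProductSpace ℂ K'] [CompleteSpace K'] {ι' : H →ₗᵢ[ℂ] K'} {B' : VonNeumannAlgebra K'}
    {θ' : B'.toStarSubalgebra →⋆ₐ[ℂ] B'.toStarSubalgebra} (hD : IsMinimalDilation τ ι B θ)
    (hD' : IsMinimalDilation τ ι' B' θ') (hτ : τ 1 = 1)
    {b c : B.toStarSubalgebra} (hb : b ∈ dilationPeripheralSpace θ)
    (hc : c ∈ dilationPeripheralSpace θ) :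
    poissonMul ι' θ' (compress ι b.1) (compress ι c.1) = compress ι (b * c).1 := by
  obtain ⟨b', hb', h1 : compress ι' b'.1 = compress ι b.1⟩ :=
    (hD'.bijOn_compress hτ).surjOn ((hD.bijOn_compress hτ).mapsTo hb)
  obtain ⟨c', hc', h2 : compress ι' c'.1 = compress ι c.1⟩ :=
    (hD'.bijOn_compress hτ).surjOn ((hD.bijOn_compress hτ).mapsTo hc)
  rw [← h1, ← h2, hD'.poissonMul_compress hτ hb' hc']
  obtain ⟨F, hF, hF', hF1⟩ := Circle.exists_filter_tendsto_pow
  ext1 h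
  -- Both products are the limit of the same τⁿ(xy)h, where x and y are the common compressions.
  refine tendsto_nhds_unique (hD'.tendsto_pow_compress_mul_compress hτ hF' hF1 hb' hc' h) ?_
  rw [h1, h2]
  exact hD.tendsto_pow_compress_mul_compress hτ hF' hF1 hb hc h

end IsMinimalDilation

/-! ### The peripheral space of θ as a C*-algebra -/

section PeripheralAlgebra

variable {K : Type*} [NormedAddCommGroup K] [InnerProductSpace ℂ K] [CompleteSpace K]
variable {B : VonNeumannAlgebra K} {θ : B.toStarSubalgebra →⋆ₐ[ℂ] B.toStarSubalgebra}

open IsMinimalDilation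

theorem mem_dilationPeripheralSpace_of_eq {b : B.toStarSubalgebra} {l : Circle}
    (h : θ b = (l : ℂ) • b) : b ∈ dilationPeripheralSpace θ :=
  eigenspace_le_peripheralSpace _ l (mem_eigenspace_iff.mpr h)

theorem dilationPeripheralSpace_le {S : Submodule ℂ B.toStarSubalgebra}
    (hS : IsClosed (S : Set B.toStarSubalgebra))
    (h : ∀ (l : Circle) (b : B.toStarSubalgebra), θ b = (l : ℂ) • b → b ∈ S) :
    dilationPeripheralSpace θ ≤ S :=
  peripheralSpace_le hS fun l b hb => h l b (mem_eigenspace_iff.mp hb)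

/-- A product of eigenvectors for λ and μ satisfies the eigenvector equation for λμ. The extension
to closed spans is made in one factor at a time. -/
theorem mul_mem_dilationPeripheralSpace {b c : B.toStarSubalgebra}
    (hb : b ∈ dilationPeripheralSpace θ) (hc : c ∈ dilationPeripheralSpace θ) :
    b * c ∈ dilationPeripheralSpace θ := by
  have h : ∀ (l : Circle) (b : B.toStarSubalgebra), θ b = (l : ℂ) • b →
      ∀ c ∈ dilationPeripheralSpace θ, b * c ∈ dilationPeripheralSpace θ := by
    intro l b hb
    refine dilationPeripheralSpace_le
      (S := (dilationPeripheralSpace θ).comap (LinearMap.mulLeft ℂ b))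
      ((isClosed_peripheralSpace _).preimage (continuous_const_mul b)) fun m c hc => ?_
    refine mem_dilationPeripheralSpace_of_eq (l := l * m) ?_
    rw [LinearMap.mulLeft_apply, map_mul, hb, hc, smul_mul_smul_comm, Circle.coe_mul]
  exact dilationPeripheralSpace_le
    (S := (dilationPeripheralSpace θ).comap (LinearMap.mulRight ℂ c))
    ((isClosed_peripheralSpace _).preimage (continuous_mul_const c))
    (fun l b hb => h l b hb c hc) hb

theorem star_mem_dilationPeripheralSpace {b : B.toStarSubalgebra}
    (hb : b ∈ dilationPeripheralSpace θ) : star b ∈ dilationPeripheralSpace θ := by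
  let S : Submodule ℂ B.toStarSubalgebra :=
    { carrier := {b | star b ∈ dilationPeripheralSpace θ}
      add_mem' := fun {b c} hb hc => by
        change star (b + c) ∈ dilationPeripheralSpace θ
        rw [star_add]
        exact Submodule.add_mem _ hb hc
      zero_mem' := by
        change star (0 : B.toStarSubalgebra) ∈ dilationPeripheralSpace θ
        rw [star_zero]
        exact Submodule.zero_mem _
      smul_mem' := fun c b hb => by
        change star (c • b) ∈ dilationPeripheralSpace θ
        rw [star_smul]
        exact Submodule.smul_mem _ _ hb }
  refine dilationPeripheralSpace_le (S := S)
    ((isClosed_peripheralSpace _).preimage continuous_star) (fun l b hb => ?_) hb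
  refine mem_dilationPeripheralSpace_of_eq (l := l⁻¹) ?_
  rw [map_star, hb, star_smul, Circle.coe_inv_eq_conj]
  rfl

variable (θ) in
/-- The peripheral space of a `*`-endomorphism is a `C*`-algebra. -/
noncomputable def peripheralStarSubalgebra : StarSubalgebra ℂ B.toStarSubalgebra where
  carrier := dilationPeripheralSpace θ
  mul_mem' := mul_mem_dilationPeripheralSpace
  add_mem' := Submodule.add_mem _
  algebraMap_mem' c :=
    mem_dilationPeripheralSpace_of_eq (l := 1) (by rw [AlgHomClass.commutes]; simp)
  star_mem' := star_mem_dilationPeripheralSpace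

end PeripheralAlgebra

/-! ### Commutation relations and covariance -/

section Rotation

theorem rotOp_mul_mulOp (l : Circle) (f : CircleLInf) :
    rotOp l * mulOp f = mulOp (rotFun l f) * rotOp l := by
  ext1 h
  apply Lp.ext
  filter_upwards [coeFn_rotOp l (mulOp f h), coeFn_mulOp (rotFun l f) (rotOp l h),
    coeFn_rotFun l f, coeFn_rotOp l h,
    (measurePreserving_rotation l).quasiMeasurePreserving.ae (coeFn_mulOp f h)]
    with z h1 h2 h3 h4 h5
  rw [mul_apply_eq_comp, mul_apply_eq_comp, h1, h2, h3, h4, h5]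

theorem mulOp_mul_mulOp (f g : CircleLInf) : mulOp f * mulOp g = mulOp (f * g) :=
  (map_mul mulRep f g).symm

theorem star_mulOp (f : CircleLInf) : star (mulOp f) = mulOp (star f) :=
  (map_star mulRep f).symm

theorem mulOp_one : mulOp 1 = 1 := map_one mulRep

theorem star_rotOp (l : Circle) : star (rotOp l) = rotOp l⁻¹ := by
  have h1 : star (rotOp l) * rotOp l = 1 := Unitary.star_mul_self_of_mem (rotOp_mem_unitary l)
  have h2 : rotOp l * rotOp l⁻¹ = 1 := by rw [rotOp_rotOp, mul_inv_cancel, rotOp_one]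
  exact left_inv_eq_right_inv h1 h2

theorem rotFun_coordFun (l : Circle) : rotFun l coordFun = (l : ℂ) • coordFun := by
  apply Lp.ext
  filter_upwards [coeFn_rotFun l coordFun, Lp.coeFn_smul (l : ℂ) coordFun, coeFn_coordFun,
    (measurePreserving_rotation l).quasiMeasurePreserving.ae coeFn_coordFun] with z h1 h2 h3 h4
  rw [h1, h2, h4, Pi.smul_apply, h3, Circle.coe_mul, smul_eq_mul]

/-- Equivalently M_z* V_λ M_z = λV_λ: the rotations are eigenvectors of the concrete dilation. -/
theorem rotOp_mul_mulOp_coordFun (l : Circle) :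
    rotOp l * mulOp coordFun = (l : ℂ) • (mulOp coordFun * rotOp l) := by
  rw [rotOp_mul_mulOp, rotFun_coordFun, ← smul_mul_assoc]
  exact congr($(map_smul mulRep (l : ℂ) coordFun) * rotOp l)

theorem isCovariantRepresentation_mulRep_rotRep :
    IsCovariantRepresentation rotationAction mulRep rotRep where
  strongly_continuous k := by
    have h : Continuous fun l : Circle =>
        (⟨fun z : Circle => l⁻¹ * z, by fun_prop⟩ : C(Circle, Circle)) :=
      ContinuousMap.continuous_of_continuous_uncurry _ (by
        simp only [Function.uncurry_def, ContinuousMap.coe_mk]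
        fun_prop)
    exact continuous_const.compMeasurePreservingLp h (fun l => measurePreserving_rotation l⁻¹)
      ENNReal.ofNat_ne_top
  covariant l f := by
    change rotOp l⁻¹ * mulOp f * star (rotOp l⁻¹) = mulOp (rotFun l⁻¹ f)
    rw [rotOp_mul_mulOp, star_rotOp, inv_inv, mul_assoc, rotOp_rotOp, inv_mul_cancel, rotOp_one,
      mul_one]

end Rotation

/-! ### Continuous symbols and the Stone–Weierstrass theorem -/

section ContinuousSymbols

theorem coeFn_toLp_top (h : C(Circle, ℂ)) :
    (ContinuousMap.toLp ∞ circleHaar ℂ h : CircleLInf) =ᵐ[circleHaar] h :=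
  ContinuousMap.coeFn_toLp circleHaar h

theorem coeFn_toLp_two (h : C(Circle, ℂ)) :
    (ContinuousMap.toLp 2 circleHaar ℂ h : CircleL2) =ᵐ[circleHaar] h :=
  ContinuousMap.coeFn_toLp circleHaar h

/-- Multiplication operators with continuous symbol. -/
noncomputable def contMulOp : C(Circle, ℂ) →L[ℂ] (CircleL2 →L[ℂ] CircleL2) :=
  (ContinuousLinearMap.mul ℂ ℂ).holderL circleHaar ∞ 2 2 ∘L ContinuousMap.toLp ∞ circleHaar ℂ

theorem contMulOp_apply (h : C(Circle, ℂ)) :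
    contMulOp h = mulOp (ContinuousMap.toLp ∞ circleHaar ℂ h) := rfl

theorem contMulOp_mul (g h : C(Circle, ℂ)) : contMulOp (g * h) = contMulOp g * contMulOp h := by
  rw [contMulOp_apply, contMulOp_apply, contMulOp_apply, mulOp_mul_mulOp]
  congr 1
  apply Lp.ext
  filter_upwards [coeFn_toLp_top (g * h), coeFn_toLp_top g, coeFn_toLp_top h,
    CircleLInf.coeFn_mul (ContinuousMap.toLp ∞ circleHaar ℂ g)
      (ContinuousMap.toLp ∞ circleHaar ℂ h)] with z h1 h2 h3 h4
  rw [h1, h4, h2, h3, ContinuousMap.mul_apply]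

theorem contMulOp_star (h : C(Circle, ℂ)) : contMulOp (star h) = star (contMulOp h) := by
  rw [contMulOp_apply, contMulOp_apply, star_mulOp]
  congr 1

theorem contMulOp_toLp (g h : C(Circle, ℂ)) :
    contMulOp g (ContinuousMap.toLp 2 circleHaar ℂ h) =
      ContinuousMap.toLp 2 circleHaar ℂ (g * h) := by
  apply Lp.ext
  filter_upwards [coeFn_toLp_top g, coeFn_toLp_two h, coeFn_toLp_two (g * h),
    coeFn_mulOp (ContinuousMap.toLp ∞ circleHaar ℂ g) (ContinuousMap.toLp 2 circleHaar ℂ h)]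
    with z h1 h2 h3 h4
  rw [contMulOp_apply, h4, h1, h2, h3, ContinuousMap.mul_apply]

/-- The inclusion of the circle in the complex plane. -/
def circleCoe : C(Circle, ℂ) := ⟨fun z => z, by fun_prop⟩

theorem contMulOp_circleCoe : contMulOp circleCoe = mulOp coordFun := rfl

theorem adjoin_circleCoe_topologicalClosure :
    (StarAlgebra.adjoin ℂ {circleCoe}).topologicalClosure = ⊤ := by
  refine ContinuousMap.starSubalgebra_topologicalClosure_eq_top_of_separatesPoints _ ?_
  intro z w hzw
  exact ⟨circleCoe, ⟨circleCoe, StarAlgebra.self_mem_adjoin_singleton ℂ _, rfl⟩,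
    fun h => hzw (Circle.ext h)⟩

/-- The function z separates points, so by Stone–Weierstrass a property that defines a closed
*-subalgebra need only be checked at z. -/
theorem mem_of_circleCoe_mem {S : StarSubalgebra ℂ C(Circle, ℂ)}
    (hS : IsClosed (S : Set C(Circle, ℂ))) (h : circleCoe ∈ S) (g : C(Circle, ℂ)) : g ∈ S := by
  have h1 : (StarAlgebra.adjoin ℂ {circleCoe}).topologicalClosure ≤ S :=
    StarSubalgebra.topologicalClosure_minimal
      (StarAlgebra.adjoin_le (Set.singleton_subset_iff.mpr h)) hS
  rw [adjoin_circleCoe_topologicalClosure] at h1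
  exact h1 (by trivial)

theorem contMulOp_algebraMap (c : ℂ) :
    contMulOp (algebraMap ℂ C(Circle, ℂ) c) = c • 1 := by
  have h1 : contMulOp 1 = 1 := mulOp_one
  rw [Algebra.algebraMap_eq_smul_one, map_smul, h1]

theorem denseRange_toLp_two :
    DenseRange (ContinuousMap.toLp 2 circleHaar ℂ : C(Circle, ℂ) →L[ℂ] CircleL2) :=
  ContinuousMap.toLp_denseRange ℂ circleHaar ℂ ENNReal.ofNat_ne_top

/-- A closed subspace that reduces `M_z` and contains the constants is everything. -/
theorem eq_top_of_reduces {L : Submodule ℂ CircleL2} (hL : IsClosed (L : Set CircleL2))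
    (h0 : monomialL2 0 ∈ L) (h1 : ∀ v ∈ L, mulOp coordFun v ∈ L)
    (h2 : ∀ v ∈ L, star (mulOp coordFun) v ∈ L) : L = ⊤ := by
  -- Invariance under the adjoint is part of the condition, so that the set is closed under `star`.
  let S : StarSubalgebra ℂ C(Circle, ℂ) :=
    { carrier := {h | ∀ v ∈ L, contMulOp h v ∈ L ∧ star (contMulOp h) v ∈ L}
      mul_mem' := fun {g h} hg hh v hv => by
        rw [contMulOp_mul, star_mul]
        exact ⟨(hg _ (hh v hv).1).1, (hh _ (hg v hv).2).2⟩
      add_mem' := fun {g h} hg hh v hv => by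
        rw [map_add, star_add]
        exact ⟨L.add_mem (hg v hv).1 (hh v hv).1, L.add_mem (hg v hv).2 (hh v hv).2⟩
      algebraMap_mem' := fun c v hv => by
        rw [contMulOp_algebraMap, star_smul, star_one]
        exact ⟨L.smul_mem _ hv, L.smul_mem _ hv⟩
      star_mem' := fun {g} hg v hv => by
        rw [contMulOp_star, star_star]
        exact (hg v hv).symm }
  have hS : IsClosed (S : Set C(Circle, ℂ)) := by
    have : (S : Set C(Circle, ℂ)) = ⋂ v ∈ L, ((fun h => contMulOp h v) ⁻¹' L) ∩
        ((fun h => star (contMulOp h) v) ⁻¹' L) := by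
      ext h
      simp only [Set.mem_iInter]
      rfl
    rw [this]
    refine isClosed_biInter fun v _ => (hL.preimage ?_).inter (hL.preimage ?_)
    · exact (ContinuousLinearMap.apply ℂ CircleL2 v).continuous.comp contMulOp.continuous
    · exact (ContinuousLinearMap.apply ℂ CircleL2 v).continuous.comp
        (continuous_star.comp contMulOp.continuous)
  refine Submodule.eq_top_iff'.mpr fun v => ?_
  have h3 : closure (Set.range (ContinuousMap.toLp 2 circleHaar ℂ : C(Circle, ℂ) →L[ℂ] CircleL2))
      ⊆ L := by
    refine closure_minimal ?_ hL
    rintro _ ⟨h, rfl⟩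
    have h4 : h ∈ S := mem_of_circleCoe_mem hS (fun v hv => ⟨h1 v hv, h2 v hv⟩) h
    have h5 := (h4 _ h0).1
    have h6 : monomialL2 0 = ContinuousMap.toLp 2 circleHaar ℂ (1 : C(Circle, ℂ)) := by
      unfold monomialL2
      congr 1
    rwa [h6, contMulOp_toLp, mul_one] at h5
  exact h3 (denseRange_toLp_two v)

end ContinuousSymbols

/-! ### The commutant of the bilateral shift -/

section Commutant

/-- An operator that commutes with the bilateral shift `M_z` is a multiplication operator. -/
theorem exists_eq_mulOp_of_commute {Z : CircleL2 →L[ℂ] CircleL2}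
    (hZ : Z * mulOp coordFun = mulOp coordFun * Z) : ∃ f : CircleLInf, Z = mulOp f := by
  have hU := mulOp_coordFun_mem_unitary
  have hZ' : Z * star (mulOp coordFun) = star (mulOp coordFun) * Z := by
    calc Z * star (mulOp coordFun)
        = star (mulOp coordFun) * (mulOp coordFun * Z) * star (mulOp coordFun) := by
          rw [← mul_assoc, Unitary.star_mul_self_of_mem hU, one_mul]
      _ = star (mulOp coordFun) * Z := by
          rw [← hZ, mul_assoc, mul_assoc, Unitary.mul_star_self_of_mem hU, mul_one]
  let S : StarSubalgebra ℂ C(Circle, ℂ) :=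
    { carrier := {h | Z * contMulOp h = contMulOp h * Z ∧
        Z * star (contMulOp h) = star (contMulOp h) * Z}
      mul_mem' := fun {g h} hg hh => by
        have hg1 : Commute Z (contMulOp g) := hg.1
        have hg2 : Commute Z (star (contMulOp g)) := hg.2
        rw [Set.mem_ofPred_eq, contMulOp_mul, star_mul]
        exact ⟨hg1.mul_right hh.1, Commute.mul_right hh.2 hg2⟩
      add_mem' := fun {g h} hg hh => by
        rw [Set.mem_ofPred_eq, map_add, star_add]
        exact ⟨Commute.add_right hg.1 hh.1, Commute.add_right hg.2 hh.2⟩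
      algebraMap_mem' := fun c => by
        rw [Set.mem_ofPred_eq, contMulOp_algebraMap, star_smul, star_one]
        exact ⟨(Commute.one_right Z).smul_right _, (Commute.one_right Z).smul_right _⟩
      star_mem' := fun {g} hg => by
        rw [Set.mem_ofPred_eq, contMulOp_star, star_star]
        exact hg.symm }
  have hS : IsClosed (S : Set C(Circle, ℂ)) := by
    have hc := contMulOp.continuous
    refine IsClosed.inter (isClosed_eq ?_ ?_) (isClosed_eq ?_ ?_) <;> fun_prop
  have hcomm : ∀ h, Z * contMulOp h = contMulOp h * Z := fun h =>
    (mem_of_circleCoe_mem hS ⟨hZ, hZ'⟩ h).1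
  set one2 : CircleL2 := ContinuousMap.toLp 2 circleHaar ℂ (1 : C(Circle, ℂ)) with hone2
  -- The symbol can only be Z1, since Zh = Z M_h 1 = M_h Z1 for continuous h.
  set φ : CircleL2 := Z one2 with hφ
  have hone : (one2 : Circle → ℂ) =ᵐ[circleHaar] fun _ => 1 := coeFn_toLp_two 1
  -- A priori φ is only in L² and φv only in L¹, so Zv = φv is extended from continuous v to all v
  -- by continuity in L¹; the factor `one2` places Zv in that space.
  let m : CircleL2 →L[ℂ] CircleL2 →L[ℂ] Lp ℂ 1 circleHaar :=
    (ContinuousLinearMap.mul ℂ ℂ).holderL circleHaar 2 2 1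
  have hm : ∀ u v : CircleL2, m u v =ᵐ[circleHaar] fun z => u z * v z := fun u v =>
    (ContinuousLinearMap.mul ℂ ℂ).coeFn_holder u v
  have hdense : ∀ v, m φ v = m one2 (Z v) := by
    refine fun v => denseRange_toLp_two.induction_on (p := fun v => m φ v = m one2 (Z v)) v ?_ ?_
    rotate_left
    · intro h
      have h1 : Z (ContinuousMap.toLp 2 circleHaar ℂ h) = contMulOp h φ := by
        have := congr($(hcomm h) one2)
        rw [mul_apply_eq_comp, contMulOp_toLp, mul_one] at this
        exact this
      rw [h1]
      apply Lp.ext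
      filter_upwards [hm φ (ContinuousMap.toLp 2 circleHaar ℂ h), hm one2 (contMulOp h φ), hone,
        coeFn_mulOp (ContinuousMap.toLp ∞ circleHaar ℂ h) φ, coeFn_toLp_top h,
        coeFn_toLp_two h] with z h1 h2 h3 h4 h5 h6
      rw [h1, h2, h3, contMulOp_apply, h4, h5, h6, one_mul, mul_comm]
    · exact isClosed_eq (m φ).continuous ((m one2).continuous.comp Z.continuous)
  have hae : ∀ v, Z v =ᵐ[circleHaar] fun z => φ z * v z := by
    intro v
    filter_upwards [hm φ v, hm one2 (Z v), hone] with z h1 h2 h3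
    rw [← h1, hdense, h2, h3, one_mul]
  have hbound : ∀ᵐ z ∂circleHaar, ‖φ z‖ ≤ ‖Z‖ + 1 := by
    -- For the indicator v of this set, (‖Z‖ + 1)‖v‖ ≤ ‖Zv‖ ≤ ‖Z‖‖v‖. The added 1 forces v = 0, so
    -- the set is null.
    have hmeas : MeasurableSet {z | ‖Z‖ + 1 < ‖φ z‖} :=
      measurableSet_lt measurable_const (Lp.stronglyMeasurable φ).measurable.norm
    set v : CircleL2 := indicatorConstLp 2 hmeas (measure_ne_top _ _) 1 with hv
    have h1 : ‖((‖Z‖ + 1 : ℝ) : ℂ) • v‖ ≤ ‖Z v‖ := by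
      refine Lp.norm_le_norm_of_ae_le ?_
      filter_upwards [hae v, Lp.coeFn_smul ((‖Z‖ + 1 : ℝ) : ℂ) v,
        indicatorConstLp_coeFn (p := 2) (hs := hmeas) (hμs := measure_ne_top circleHaar _)
          (c := (1 : ℂ))] with z h1 h2 h3
      rw [h1, h2, Pi.smul_apply, hv, h3]
      by_cases hz : ‖Z‖ + 1 < ‖φ z‖
      · rw [Set.indicator_of_mem (by exact hz)]
        simp only [smul_eq_mul, mul_one, Complex.norm_real]
        rw [Real.norm_of_nonneg (by positivity)]
        exact hz.le
      · rw [Set.indicator_of_notMem (by exact hz)]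
        simp
    rw [norm_smul, Complex.norm_real, Real.norm_of_nonneg (by positivity)] at h1
    have h2 : v = 0 := by
      have := Z.le_opNorm v
      exact norm_le_zero_iff.mp (by linarith)
    filter_upwards [Lp.eq_zero_iff_ae_eq_zero.mp h2,
      indicatorConstLp_coeFn (p := 2) (hs := hmeas) (hμs := measure_ne_top circleHaar _)
        (c := (1 : ℂ))] with z h3 h4
    by_contra hz
    rw [← hv, h3, Set.indicator_of_mem (by exact not_le.mp hz)] at h4
    exact zero_ne_one h4
  have hmem : MemLp φ ∞ circleHaar :=
    memLp_top_of_bound (Lp.aestronglyMeasurable φ) _ hbound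
  refine ⟨hmem.toLp φ, ?_⟩
  ext1 v
  apply Lp.ext
  filter_upwards [hae v, coeFn_mulOp (hmem.toLp φ) v, hmem.coeFn_toLp] with z h1 h2 h3
  rw [h1, h2, h3]

end Commutant

/-! ### The bilateral shift as a dilation of τ -/

section HardyShift

theorem mulOp_coordFun_monomialL2 (n : ℕ) : mulOp coordFun (monomialL2 n) = monomialL2 (n + 1) := by
  rw [← contMulOp_circleCoe]
  refine (contMulOp_toLp _ _).trans ?_
  unfold monomialL2
  congr 1
  ext z
  exact (pow_succ' _ _).symm

theorem mulOp_coordFun_pow_monomialL2 (n k : ℕ) :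
    (mulOp coordFun ^ n) (monomialL2 k) = monomialL2 (n + k) := by
  induction n with
  | zero => simp
  | succ n ih => rw [pow_succ', mul_apply_eq_comp, ih, mulOp_coordFun_monomialL2]; congr 1; omega

theorem inner_monomialL2_self (n : ℕ) : inner ℂ (monomialL2 n) (monomialL2 n) = 1 := by
  rw [L2.inner_def]
  have : ∀ᵐ z ∂circleHaar, inner ℂ (monomialL2 n z) (monomialL2 n z) = (1 : ℂ) := by
    filter_upwards [coeFn_toLp_two ⟨fun z : Circle => (z : ℂ) ^ n, by fun_prop⟩] with z hz
    rw [monomialL2, hz, inner_self_eq_norm_sq_to_K, ContinuousMap.coe_mk, norm_pow, z.norm_coe]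
    simp
  rw [integral_congr_ae this]
  simp

theorem monomialL2_mem_hardySpace (n : ℕ) : monomialL2 n ∈ hardySpace :=
  Submodule.le_topologicalClosure _ (Submodule.subset_span ⟨n, rfl⟩)

theorem mulOp_coordFun_mem_hardySpace {v : CircleL2} (hv : v ∈ hardySpace) :
    mulOp coordFun v ∈ hardySpace := by
  have h : hardySpace ≤ hardySpace.comap (mulOp coordFun).toLinearMap := by
    refine Submodule.topologicalClosure_minimal _ (Submodule.span_le.mpr ?_)
      ((Submodule.isClosed_topologicalClosure _).preimage (mulOp coordFun).continuous)
    rintro _ ⟨n, rfl⟩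
    change mulOp coordFun (monomialL2 n) ∈ hardySpace
    rw [mulOp_coordFun_monomialL2]
    exact monomialL2_mem_hardySpace _
  exact h hv

theorem hardyIncl_shift (h : hardySpace) : hardyIncl (shift h) = mulOp coordFun (hardyIncl h) := by
  have h1 : mulOp coordFun (hardyIncl h) = hardyIncl ⟨_, mulOp_coordFun_mem_hardySpace h.2⟩ := rfl
  rw [shift, compress_apply, h1, adjoint_isometry_apply_apply]

theorem mem_fullVonNeumannAlgebra {K : Type*} [NormedAddCommGroup K] [InnerProductSpace ℂ K]
    [CompleteSpace K] (Z : K →L[ℂ] K) : Z ∈ (fullVonNeumannAlgebra K).toStarSubalgebra :=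
  trivial

theorem mulOp_coordFun_comp_hardyIncl :
    mulOp coordFun ∘L hardyIncl.toContinuousLinearMap =
      hardyIncl.toContinuousLinearMap ∘L shift := by
  ext1 h
  exact (hardyIncl_shift h).symm

theorem coe_shiftDilation (Z : (fullVonNeumannAlgebra CircleL2).toStarSubalgebra) :
    (shiftDilation Z).1 = star (mulOp coordFun) * Z.1 * mulOp coordFun := rfl

/-- M_z leaves H² invariant and restricts to S; taking adjoints, P M_z* = S*P. -/
theorem compress_shiftDilation (Z : (fullVonNeumannAlgebra CircleL2).toStarSubalgebra) :
    compress hardyIncl (shiftDilation Z).1 = shiftMap (compress hardyIncl Z.1) := by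
  have h1 := congr(adjoint $mulOp_coordFun_comp_hardyIncl)
  rw [adjoint_comp, adjoint_comp] at h1
  ext1 h
  have h2 := hardyIncl_shift h
  change adjoint hardyIncl.toContinuousLinearMap
    (adjoint (mulOp coordFun) (Z.1 (mulOp coordFun (hardyIncl h)))) =
      adjoint shift (adjoint hardyIncl.toContinuousLinearMap (Z.1 (hardyIncl (shift h))))
  rw [h2]
  exact congr($h1 (Z.1 (mulOp coordFun (hardyIncl h))))

theorem shiftMap_one : shiftMap 1 = 1 := by
  rw [← compress_one hardyIncl]
  have h := compress_shiftDilation 1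
  rw [map_one] at h
  exact h.symm

theorem compress_iterate_shiftDilation (n : ℕ)
    (Z : (fullVonNeumannAlgebra CircleL2).toStarSubalgebra) :
    compress hardyIncl (shiftDilation^[n] Z).1 = (shiftMap ^ n) (compress hardyIncl Z.1) := by
  induction n with
  | zero => rfl
  | succ n ih =>
    rw [Function.iterate_succ_apply', compress_shiftDilation, ih, pow_succ']
    rfl

theorem coe_iterate_shiftDilation (n : ℕ)
    (Z : (fullVonNeumannAlgebra CircleL2).toStarSubalgebra) :
    (shiftDilation^[n] Z).1 = star (mulOp coordFun ^ n) * Z.1 * mulOp coordFun ^ n := by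
  induction n with
  | zero => simp
  | succ n ih =>
    rw [Function.iterate_succ_apply', coe_shiftDilation, ih, pow_succ, star_mul]
    simp only [mul_assoc]

/-- Conjugation by a unitary is an order automorphism: an upper bound u of the image comes from the
upper bound M_z u M_z*. -/
theorem scottContinuous_shiftDilation : ScottContinuous shiftDilation := by
  have hU := mulOp_coordFun_mem_unitary
  have hmono : Monotone shiftDilation := fun b c hbc => by
    change (shiftDilation b).1 ≤ (shiftDilation c).1
    exact star_left_conjugate_le_conjugate (show b.1 ≤ c.1 from hbc) _
  intro d _ _ a ha
  refine ⟨hmono.mem_upperBounds_image ha.1, fun u hu => ?_⟩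
  let u' : (fullVonNeumannAlgebra CircleL2).toStarSubalgebra :=
    ⟨mulOp coordFun * u.1 * star (mulOp coordFun), trivial⟩
  have hu' : shiftDilation u' = u := Subtype.ext (by
    rw [coe_shiftDilation]
    change star (mulOp coordFun) * (mulOp coordFun * u.1 * star (mulOp coordFun)) *
      mulOp coordFun = u.1
    rw [mul_assoc, mul_assoc, mul_assoc, Unitary.star_mul_self_of_mem hU, mul_one, ← mul_assoc,
      Unitary.star_mul_self_of_mem hU, one_mul])
  rw [← hu']
  refine hmono (ha.2 fun b hb => ?_)
  have h1 : (shiftDilation b).1 ≤ u.1 := hu ⟨b, hb, rfl⟩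
  have h2 := star_right_conjugate_le_conjugate h1 (mulOp coordFun)
  have h3 : mulOp coordFun * (shiftDilation b).1 * star (mulOp coordFun) = b.1 := by
    rw [coe_shiftDilation, mul_assoc, mul_assoc, Unitary.mul_star_self_of_mem hU, mul_one,
      ← mul_assoc, Unitary.mul_star_self_of_mem hU, one_mul]
  rw [h3] at h2
  exact h2

end HardyShift

/-! ### Minimality of the concrete dilation -/

section Laurent

/-- The function `z ↦ z ^ (k - n)`. -/
noncomputable def laurentL2 (n k : ℕ) : CircleL2 := star (mulOp coordFun ^ n) (monomialL2 k)

theorem mulOp_coordFun_pow_mem_unitary (n : ℕ) :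
    mulOp coordFun ^ n ∈ unitary (CircleL2 →L[ℂ] CircleL2) :=
  pow_mem mulOp_coordFun_mem_unitary n

theorem laurentL2_self (n : ℕ) : laurentL2 n n = monomialL2 0 := by
  have h := mulOp_coordFun_pow_monomialL2 n 0
  rw [add_zero] at h
  rw [laurentL2, ← h, ← mul_apply_eq_comp,
    Unitary.star_mul_self_of_mem (mulOp_coordFun_pow_mem_unitary n), one_apply_eq_self]

theorem star_mulOp_coordFun_laurentL2 (n k : ℕ) :
    star (mulOp coordFun) (laurentL2 n k) = laurentL2 (n + 1) k := by
  rw [laurentL2, laurentL2, pow_succ, star_mul, mul_apply_eq_comp]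

theorem mulOp_coordFun_laurentL2 (n k : ℕ) :
    mulOp coordFun (laurentL2 n k) = laurentL2 n (k + 1) := by
  rw [laurentL2, laurentL2, ← mulOp_coordFun_monomialL2, ← mul_apply_eq_comp, ← mul_apply_eq_comp]
  have h : Commute (mulOp coordFun) (star (mulOp coordFun ^ n)) := by
    rw [star_pow]
    refine Commute.pow_right ?_ n
    exact (Unitary.mul_star_self_of_mem mulOp_coordFun_mem_unitary).trans
      (Unitary.star_mul_self_of_mem mulOp_coordFun_mem_unitary).symm
  rw [h.eq]

/-- The closed span of the z^{k−n} reduces M_z and contains the constants, so `eq_top_of_reduces`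
applies to it. -/
theorem eq_top_of_laurentL2_mem {L : Submodule ℂ CircleL2} (hL : IsClosed (L : Set CircleL2))
    (h : ∀ n k, laurentL2 n k ∈ L) : L = ⊤ := by
  set L₀ := (Submodule.span ℂ {v | ∃ n k, v = laurentL2 n k}).topologicalClosure with hL₀
  have hle : L₀ ≤ L := by
    refine Submodule.topologicalClosure_minimal _ (Submodule.span_le.mpr ?_) hL
    rintro _ ⟨n, k, rfl⟩
    exact h n k
  have hmem : ∀ n k, laurentL2 n k ∈ L₀ := fun n k =>
    Submodule.le_topologicalClosure _ (Submodule.subset_span ⟨n, k, rfl⟩)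
  have hcl : IsClosed (L₀ : Set CircleL2) := Submodule.isClosed_topologicalClosure _
  have hinv : ∀ A : CircleL2 →L[ℂ] CircleL2, (∀ n k, A (laurentL2 n k) ∈ L₀) →
      ∀ v ∈ L₀, A v ∈ L₀ := by
    intro A hA
    change L₀ ≤ L₀.comap A.toLinearMap
    refine Submodule.topologicalClosure_minimal _ (Submodule.span_le.mpr ?_)
      (hcl.preimage A.continuous)
    rintro _ ⟨n, k, rfl⟩
    exact hA n k
  refine top_le_iff.mp (le_trans (top_le_iff.mpr ?_) hle)
  refine eq_top_of_reduces hcl (laurentL2_self 0 ▸ hmem 0 0) (hinv _ fun n k => ?_)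
    (hinv _ fun n k => ?_)
  · rw [mulOp_coordFun_laurentL2]
    exact hmem _ _
  · rw [star_mulOp_coordFun_laurentL2]
    exact hmem _ _

/-- The function `z ^ n` in the Hardy space. -/
noncomputable def hardyMonomial (n : ℕ) : hardySpace := ⟨monomialL2 n, monomialL2_mem_hardySpace n⟩

/-- The rank one operator on the Hardy space that sends `z ^ n` to `z ^ k`. -/
noncomputable def hardyRankOne (n k : ℕ) : hardySpace →L[ℂ] hardySpace :=
  (innerSL ℂ (hardyMonomial n)).smulRight (hardyMonomial k)

/-- Applying (M_z*)ⁿ carries e_n to e_0 and e_k to z^{k−n}. The resulting rank one operators give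
both halves of minimality. -/
theorem dilationPower_hardyRankOne
    (hB : ∀ x, inflate hardyIncl x ∈ (fullVonNeumannAlgebra CircleL2).toStarSubalgebra)
    (n k : ℕ) (v : CircleL2) :
    dilationPower hB shiftDilation n (hardyRankOne n k) v =
      (inner ℂ (monomialL2 0) v : ℂ) • laurentL2 n k := by
  have h1 : inner ℂ (hardyMonomial n) (adjoint hardyIncl.toContinuousLinearMap
      ((mulOp coordFun ^ n) v)) = (inner ℂ (monomialL2 0) v : ℂ) := by
    rw [adjoint_inner_right]
    change inner ℂ (monomialL2 n) _ = _
    rw [← adjoint_inner_left, ← star_eq_adjoint]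
    exact congr(inner ℂ $(laurentL2_self n) v)
  rw [dilationPower, coe_iterate_shiftDilation]
  change star (mulOp coordFun ^ n) (hardyIncl ((inner ℂ (hardyMonomial n)
    (adjoint hardyIncl.toContinuousLinearMap ((mulOp coordFun ^ n) v)) : ℂ) •
      hardyMonomial k)) = _
  rw [h1, map_smul, map_smul]
  rfl

theorem exists_dilationWord_eq_laurentL2
    (hB : ∀ x, inflate hardyIncl x ∈ (fullVonNeumannAlgebra CircleL2).toStarSubalgebra)
    (n k : ℕ) : ∃ x h, laurentL2 n k = dilationWord hB shiftDilation x h n := by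
  cases n with
  | zero => exact ⟨0, hardyMonomial k, by simp [laurentL2, dilationWord]; rfl⟩
  | succ n =>
    -- For 1 ≤ j ≤ n the j-th factor becomes the projection onto the constants and fixes e_0; only
    -- the last factor moves e_0, to z^{k−(n+1)}. The value at 0 never enters a word.
    let x : ℕ → (hardySpace →L[ℂ] hardySpace) := fun j =>
      hardyRankOne j (if j = n + 1 then k else j)
    refine ⟨x, hardyMonomial 0, ?_⟩
    have h1 : ∀ m ≤ n, dilationWord hB shiftDilation x (hardyMonomial 0) m = monomialL2 0 := by
      intro m hm
      induction m with
      | zero => rfl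
      | succ m ih =>
        rw [dilationWord, ih (by omega)]
        simp only [x]
        rw [if_neg (by omega), dilationPower_hardyRankOne, inner_monomialL2_self, one_smul,
          laurentL2_self]
    rw [dilationWord, h1 n le_rfl]
    simp only [x, if_true]
    rw [dilationPower_hardyRankOne, inner_monomialL2_self, one_smul]

theorem compress_dilationPower_shiftDilation
    (hB : ∀ x, inflate hardyIncl x ∈ (fullVonNeumannAlgebra CircleL2).toStarSubalgebra)
    (n : ℕ) (x : hardySpace →L[ℂ] hardySpace) :
    compress hardyIncl (dilationPower hB shiftDilation n x) = (shiftMap ^ n) x := by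
  have h : compress hardyIncl (dilationPower hB shiftDilation n x) =
      (shiftMap ^ n) (compress hardyIncl (inflate hardyIncl x)) :=
    compress_iterate_shiftDilation n ⟨inflate hardyIncl x, hB x⟩
  rwa [compress_inflate] at h

theorem isMinimalDilation_shiftDilation :
    IsMinimalDilation shiftMap hardyIncl (fullVonNeumannAlgebra CircleL2) shiftDilation where
  inflate_mem x := mem_fullVonNeumannAlgebra _
  normal := scottContinuous_shiftDilation
  dilation n x := (compress_dilationPower_shiftDilation _ n x).symm
  minimal_space := by
    refine eq_top_of_laurentL2_mem (Submodule.isClosed_topologicalClosure _) fun n k => ?_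
    obtain ⟨x, h, hx⟩ := exists_dilationWord_eq_laurentL2 (fun _ => mem_fullVonNeumannAlgebra _) n k
    exact Submodule.le_topologicalClosure _ (Submodule.subset_span ⟨n, x, h, hx⟩)
  minimal_algebra C hC := by
    intro Z _
    change Z ∈ (C : Set _)
    rw [← VonNeumannAlgebra.centralizer_centralizer]
    intro y hy
    -- Let y commute with `C`, which contains the rank one operators v ↦ ⟨e_0, v⟩z^{k−n}. Evaluating
    -- the commutation at e_0 gives y z^{k−n} = ⟨e_0, y e_0⟩ z^{k−n}, so y is scalar. Hence the
    -- bicommutant of `C`, which is `C`, is everything.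
    have hcl : IsClosed {v | y v = (inner ℂ (monomialL2 0) (y (monomialL2 0)) : ℂ) • v} :=
      isClosed_eq y.continuous (continuous_const_smul _)
    have h1 := eq_top_of_laurentL2_mem (L := LinearMap.eqLocus y.toLinearMap
      ((inner ℂ (monomialL2 0) (y (monomialL2 0)) : ℂ) • LinearMap.id)) (by exact hcl) fun n k => by
        have h2 := congr($(hy _ (hC n (hardyRankOne n k))) (monomialL2 0))
        rw [mul_apply_eq_comp, mul_apply_eq_comp, dilationPower_hardyRankOne,
          dilationPower_hardyRankOne, inner_monomialL2_self, one_smul] at h2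
        exact h2.symm
    have h3 : ∀ v, y v = (inner ℂ (monomialL2 0) (y (monomialL2 0)) : ℂ) • v := fun v => by
      have : v ∈ (⊤ : Submodule ℂ CircleL2) := trivial
      rwa [← h1] at this
    ext1 v
    rw [mul_apply_eq_comp, mul_apply_eq_comp, h3, h3 v, map_smul]

end Laurent

/-! ### Eigenvectors of the concrete dilation and λ-Toeplitz operators -/

section LambdaToeplitz

/-- The eigenvectors of the dilation are the operators `M_f V_l`. -/
theorem shiftDilation_eq_smul_iff (l : Circle)
    (Z : (fullVonNeumannAlgebra CircleL2).toStarSubalgebra) :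
    shiftDilation Z = (l : ℂ) • Z ↔ ∃ f, Z.1 = mulOp f * rotOp l := by
  have hU := mulOp_coordFun_mem_unitary
  have h0 : shiftDilation Z = (l : ℂ) • Z ↔
      Z.1 * mulOp coordFun = (l : ℂ) • (mulOp coordFun * Z.1) := by
    rw [Subtype.ext_iff]
    change star (mulOp coordFun) * Z.1 * mulOp coordFun = (l : ℂ) • Z.1 ↔ _
    constructor <;> intro h
    · rw [← mul_smul_comm, ← h, mul_assoc, ← mul_assoc (mulOp coordFun),
        Unitary.mul_star_self_of_mem hU, one_mul]
    · rw [mul_assoc, h, mul_smul_comm, ← mul_assoc, Unitary.star_mul_self_of_mem hU, one_mul]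
  rw [h0]
  constructor
  · intro h
    -- Commuting V_λ⁻¹ past M_z produces λ⁻¹, which cancels the λ from Z; the product therefore lies
    -- in the commutant of M_z.
    have h1 : (Z.1 * rotOp l⁻¹) * mulOp coordFun = mulOp coordFun * (Z.1 * rotOp l⁻¹) := by
      rw [mul_assoc, rotOp_mul_mulOp_coordFun, mul_smul_comm, ← mul_assoc, h, smul_mul_assoc,
        smul_smul, Circle.coe_inv, inv_mul_cancel₀ l.coe_ne_zero, one_smul, mul_assoc]
    obtain ⟨f, hf⟩ := exists_eq_mulOp_of_commute h1
    exact ⟨f, by rw [← hf, mul_assoc, rotOp_rotOp, inv_mul_cancel, rotOp_one, mul_one]⟩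
  · rintro ⟨f, hf⟩
    rw [hf, mul_assoc, rotOp_mul_mulOp_coordFun, mul_smul_comm, ← mul_assoc, ← mul_assoc,
      mulOp_mul_mulOp, mulOp_mul_mulOp, mul_comm f]

theorem mulOp_mul_rotOp_mem (f : CircleLInf) (l : Circle) :
    (⟨mulOp f * rotOp l, trivial⟩ : (fullVonNeumannAlgebra CircleL2).toStarSubalgebra) ∈
      dilationPeripheralSpace shiftDilation :=
  mem_dilationPeripheralSpace_of_eq ((shiftDilation_eq_smul_iff l _).mpr ⟨f, rfl⟩)

theorem eigenspace_shiftMap (l : Circle) :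
    (Module.End.eigenspace shiftMap (l : ℂ) : Set (hardySpace →L[ℂ] hardySpace)) =
      Set.range (toeplitz l) := by
  rw [← isMinimalDilation_shiftDilation.image_eigenspace shiftMap_one]
  ext x
  constructor
  · rintro ⟨b, hb, rfl⟩
    obtain ⟨f, hf⟩ := (shiftDilation_eq_smul_iff l b).mp hb
    exact ⟨f, by rw [toeplitz, ← hf]⟩
  · rintro ⟨f, rfl⟩
    exact ⟨⟨mulOp f * rotOp l, trivial⟩, (shiftDilation_eq_smul_iff l _).mpr ⟨f, rfl⟩, rfl⟩

theorem image_dilationPeripheralSpace_shiftDilation :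
    Subtype.val '' (dilationPeripheralSpace shiftDilation :
        Set (fullVonNeumannAlgebra CircleL2).toStarSubalgebra) =
      (generatedCStarAlgebra mulRep rotRep : Set (CircleL2 →L[ℂ] CircleL2)) := by
  refine Set.Subset.antisymm ?_ ?_
  · rintro _ ⟨b, hb, rfl⟩
    have hcl : IsClosed (generatedCStarAlgebra mulRep rotRep : Set (CircleL2 →L[ℂ] CircleL2)) :=
      StarSubalgebra.isClosed_topologicalClosure _
    refine dilationPeripheralSpace_le
      (S := (generatedCStarAlgebra mulRep rotRep).toSubmodule.comap
        (fullVonNeumannAlgebra CircleL2).toStarSubalgebra.toSubmodule.subtype)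
      (hcl.preimage continuous_subtype_val) (fun l b hb => ?_) hb
    obtain ⟨f, hf⟩ := (shiftDilation_eq_smul_iff l b).mp hb
    change b.1 ∈ generatedCStarAlgebra mulRep rotRep
    rw [hf]
    have hsub := StarAlgebra.subset_adjoin ℂ
      (Set.range mulRep ∪ Set.range fun g => (rotRep g : CircleL2 →L[ℂ] CircleL2))
    refine StarSubalgebra.le_topologicalClosure _ (mul_mem (hsub (Or.inl ⟨f, rfl⟩))
      (hsub (Or.inr ⟨l⁻¹, ?_⟩)))
    change rotOp (l⁻¹)⁻¹ = rotOp l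
    rw [inv_inv]
  -- The peripheral space is a closed *-algebra, so it suffices that it contains the generators M_f
  -- = M_f V_1 and V_λ = M_1 V_λ.
  · let S := (peripheralStarSubalgebra shiftDilation).map
      (fullVonNeumannAlgebra CircleL2).toStarSubalgebra.subtype
    have hS : IsClosed (S : Set (CircleL2 →L[ℂ] CircleL2)) :=
      (fullVonNeumannAlgebra CircleL2).isClosed.isClosedEmbedding_subtypeVal.isClosedMap _
        (isClosed_peripheralSpace _)
    refine StarSubalgebra.topologicalClosure_minimal (t := S) (StarAlgebra.adjoin_le ?_) hS
    rintro _ (⟨f, rfl⟩ | ⟨l, rfl⟩)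
    · refine ⟨_, mulOp_mul_rotOp_mem f 1, ?_⟩
      change mulOp f * rotOp 1 = mulOp f
      rw [rotOp_one, mul_one]
    · refine ⟨_, mulOp_mul_rotOp_mem 1 l⁻¹, ?_⟩
      change mulOp 1 * rotOp l⁻¹ = rotOp l⁻¹
      rw [mulOp_one, one_mul]

theorem mulOp_mul_rotOp_mul (l m : Circle) (f g : CircleLInf) :
    mulOp f * rotOp l * (mulOp g * rotOp m) = mulOp (f * rotFun l g) * rotOp (l * m) := by
  rw [← mulOp_mul_mulOp, ← rotOp_rotOp, mul_assoc, ← mul_assoc (rotOp l), rotOp_mul_mulOp]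
  simp only [mul_assoc]

end LambdaToeplitz

/-! ### The main theorem -/

theorem theorem3p3 :
    -- `(π, u)` is a covariant representation of `(𝕋, L^∞(𝕋), α)` on `L²(𝕋)`
    IsCovariantRepresentation rotationAction mulRep rotRep ∧
    -- the peripheral eigenspaces of `τ` consist of the `l`-Toeplitz operators
    (∀ l : Circle,
      (Module.End.eigenspace shiftMap (l : ℂ) : Set (hardySpace →L[ℂ] hardySpace)) =
        Set.range (toeplitz l)) ∧
    -- `(L²(𝕋), B(L²(𝕋)), θ)` is a minimal dilation of `τ`, and the `C*`-algebra of the peripheral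
    -- eigenvectors of `θ` is the one generated by `(π, u)`
    IsMinimalDilation shiftMap hardyIncl (fullVonNeumannAlgebra CircleL2) shiftDilation ∧
    Subtype.val '' (dilationPeripheralSpace shiftDilation :
        Set (fullVonNeumannAlgebra CircleL2).toStarSubalgebra) =
      (generatedCStarAlgebra mulRep rotRep : Set (CircleL2 →L[ℂ] CircleL2)) ∧
    -- whatever minimal dilation is used to define the peripheral Poisson boundary of `τ`:
    ∀ (K : Type*) [NormedAddCommGroup K] [InnerProductSpace ℂ K] [CompleteSpace K]
      (ι : hardySpace →ₗᵢ[ℂ] K) (B : VonNeumannAlgebra K)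
      (θ : B.toStarSubalgebra →⋆ₐ[ℂ] B.toStarSubalgebra),
      IsMinimalDilation shiftMap ι B θ →
      -- the compression is an isometric bijection, so the product is well defined
      Set.BijOn (fun b : B.toStarSubalgebra => compress ι b.1)
        (dilationPeripheralSpace θ : Set B.toStarSubalgebra)
        (peripheralSpace shiftMap : Set (hardySpace →L[ℂ] hardySpace)) ∧
      (∀ b ∈ dilationPeripheralSpace θ, ‖compress ι b.1‖ = ‖b.1‖) ∧
      -- the product of two `l`-Toeplitz operators
      (∀ (l m : Circle) (f g : CircleLInf),
        poissonMul ι θ (toeplitz l f) (toeplitz m g) = toeplitz (l * m) (f * rotFun l g)) ∧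
      -- `X ↦ P X|_{H²}` is an isometric unital `*`-isomorphism of the `C*`-algebra generated by
      -- `(π, u)` onto the peripheral Poisson boundary
      Set.BijOn (compress hardyIncl)
        (generatedCStarAlgebra mulRep rotRep : Set (CircleL2 →L[ℂ] CircleL2))
        (peripheralSpace shiftMap : Set (hardySpace →L[ℂ] hardySpace)) ∧
      (∀ X ∈ generatedCStarAlgebra mulRep rotRep, ‖compress hardyIncl X‖ = ‖X‖) ∧
      compress hardyIncl 1 = 1 ∧
      (∀ X ∈ generatedCStarAlgebra mulRep rotRep,
        compress hardyIncl (star X) = star (compress hardyIncl X)) ∧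
      (∀ X ∈ generatedCStarAlgebra mulRep rotRep, ∀ Y ∈ generatedCStarAlgebra mulRep rotRep,
        compress hardyIncl (X * Y) =
          poissonMul ι θ (compress hardyIncl X) (compress hardyIncl Y)) := by
  have hD₀ := isMinimalDilation_shiftDilation
  have himage := image_dilationPeripheralSpace_shiftDilation
  refine ⟨isCovariantRepresentation_mulRep_rotRep, eigenspace_shiftMap, hD₀, himage, ?_⟩
  intro K _ _ _ ι B θ hD
  refine ⟨hD.bijOn_compress shiftMap_one, fun b hb => hD.norm_compress shiftMap_one hb, ?_, ?_, ?_,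
    compress_one hardyIncl, fun X _ => compress_star hardyIncl X, ?_⟩
  · intro l m f g
    -- Independence of the dilation allows the product to be computed in B(L²(𝕋)), where T_{λ,f}
    -- lifts to M_f V_λ.
    refine (hD₀.poissonMul_compress_of_dilation hD shiftMap_one (mulOp_mul_rotOp_mem f l)
      (mulOp_mul_rotOp_mem g m)).trans ?_
    exact congrArg (compress hardyIncl) (mulOp_mul_rotOp_mul l m f g)
  · rw [← himage]
    have h := hD₀.bijOn_compress shiftMap_one
    refine ⟨Set.forall_mem_image.mpr h.mapsTo, ?_, ?_⟩
    · rintro _ ⟨b, hb, rfl⟩ _ ⟨c, hc, rfl⟩ hbc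
      exact congrArg Subtype.val (h.injOn hb hc hbc)
    · intro x hx
      obtain ⟨b, hb, rfl⟩ := h.surjOn hx
      exact ⟨b.1, ⟨b, hb, rfl⟩, rfl⟩
  · intro X hX
    rw [← SetLike.mem_coe, ← himage] at hX
    obtain ⟨b, hb, rfl⟩ := hX
    exact hD₀.norm_compress shiftMap_one hb
  · intro X hX Y hY
    rw [← SetLike.mem_coe, ← himage] at hX hY
    obtain ⟨b, hb, rfl⟩ := hX
    obtain ⟨c, hc, rfl⟩ := hY
    exact (hD₀.poissonMul_compress_of_dilation hD shiftMap_one hb hc).symm
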